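/- Let $\alpha,\beta:(0,\infty)\to[0,\infty)$ be piecewise continuous and nonnegative, and suppose that the integrals $$\int_0^\infty\alpha(\xi)\,\xi^2\,d\xi,\quad \int_0^\infty\alpha(\xi)\,\xi^4\,d\xi,\quad \int_0^\infty\alpha(\xi)\,\xi^6\,d\xi,\quad \int_0^\infty\beta(\xi)\,\xi^3\,d\xi,\quad \int_0^\infty\beta(\xi)\,\xi^{5/2}\,d\xi,\quad \int_0^\infty\beta(\xi)\,\xi^5\,d\xi$$ are positive and finite. For $\eta>0$ let $(\mathcal A_\eta W)(x)=\frac1\eta\int_{x-\eta/2}^{x+\eta/2}W(y)\,dy$. Set $$d_1=\frac{12}{\int_0^\infty\alpha(\xi)\xi^4\,d\xi},\qquad d_2=\frac{12\int_0^\infty\beta(\xi)\xi^3\,d\xi}{\int_0^\infty\alpha(\xi)\xi^4\,d\xi},\qquad W_0(x)=\frac{3d_1}{2d_2}\,\operatorname{sech}^2\!\Big(\tfrac12\sqrt{d_1}\,x\Big).$$ For $\varepsilon>0$ and $V\in L^2(\mathbb R)$ (real-valued) define $$\mathcal B_\varepsilon V=V+\int_0^\infty\alpha(\xi)\,\xi^2\,\frac{V-\mathcal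 A_{\varepsilon\xi}^2V}{\varepsilon^2}\,d\xi,\qquad \mathcal M_\varepsilon V=2\int_0^\infty\beta(\xi)\,\xi^3\,\mathcal A_{\varepsilon\xi}\big((\mathcal A_{\varepsilon\xi}W_0)(\mathcal A_{\varepsilon\xi}V)\big)\,d\xi,\qquad \mathcal L_\varepsilon V=\mathcal B_\varepsilon V-\mathcal M_\varepsilon V,$$ the integrals being Bochner integrals in $L^2(\mathbb R)$. Let $L^2_{\mathrm{even}}(\mathbb R)$ be the closed subspace of even functions. Then there is $\varepsilon_0>0$ such that for every $0<\varepsilon_*\le\varepsilon_0$ there is a constant $C>0$ (depending on $\varepsilon_*$, but not on $\varepsilon$) such that the following holds for all $0<\varepsilon\le\varepsilon_*$: the two Bochner integrals exist for every $V\in L^2(\mathbb R)$, $\mathcal L_\varepsilon$ restricts to a bounded linear bijection of $L^2_{\mathrm{even}}(\mathbb R)$ onto itself with bounded inverse, and $$\|\mathcal L_\varepsilon^{-1}G\|_2\le C\,\|G\|_2\qquad\text{for all }G\in L^2_{\mathrm{even}}(\mathbb R).$$ -/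

import Mathlib

open MeasureTheory Set Filter Topology

noncomputable section

namespace PeridynamicKdV

/-- Piecewise continuity on `(0,∞)`: in every compact subinterval of `(0,∞)` there are at most
finitely many points of discontinuity, and the one-sided limits exist in each of them. -/
def PiecewiseContinuous (f : ℝ → ℝ) : Prop :=
  ∃ S : Set ℝ, (∀ a b : ℝ, 0 < a → (S ∩ Icc a b).Finite) ∧
    (∀ x : ℝ, 0 < x → x ∉ S → ContinuousAt f x) ∧
    (∀ x : ℝ, 0 < x → x ∈ S →
      (∃ l : ℝ, Tendsto f (𝓝[<] x) (𝓝 l)) ∧ (∃ r : ℝ, Tendsto f (𝓝[>] x) (𝓝 r)))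

/-- The integral `∫₀^∞ f(ξ) ξ^p dξ` exists, is finite and positive. -/
def PosFiniteMoment (f : ℝ → ℝ) (p : ℝ) : Prop :=
  IntegrableOn (fun ξ => f ξ * ξ ^ p) (Ioi 0) ∧ 0 < ∫ ξ in Ioi (0 : ℝ), f ξ * ξ ^ p

/-- The standing assumptions on the coefficient functions of the linear and the quadratic part of
the peridynamic force. -/
structure Admissible (α β : ℝ → ℝ) : Prop where
  α_piecewise : PiecewiseContinuous α
  β_piecewise : PiecewiseContinuous β
  α_nonneg : ∀ ξ : ℝ, 0 < ξ → 0 ≤ α ξ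
  β_nonneg : ∀ ξ : ℝ, 0 < ξ → 0 ≤ β ξ
  α_two : PosFiniteMoment α 2
  α_four : PosFiniteMoment α 4
  α_six : PosFiniteMoment α 6
  β_three : PosFiniteMoment β 3
  β_five_halves : PosFiniteMoment β (5 / 2)
  β_five : PosFiniteMoment β 5

/-- The real Hilbert space `L²(ℝ)`. -/
abbrev L2 : Type := Lp ℝ 2 (volume : Measure ℝ)

/-- The closed subspace `L²_even(ℝ)` of even functions. -/
def L2even : Submodule ℝ L2 where
  carrier := {W | ∀ᵐ x : ℝ, W (-x) = W x}
  zero_mem' := by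
    have h := Lp.coeFn_zero ℝ 2 (volume : Measure ℝ)
    have h' := (Measure.measurePreserving_neg (volume : Measure ℝ)).quasiMeasurePreserving.ae h
    filter_upwards [h, h'] with x h1 h2
    rw [h1, h2]; rfl
  add_mem' := by
    intro U W hU hW
    have h := Lp.coeFn_add U W
    have h' := (Measure.measurePreserving_neg (volume : Measure ℝ)).quasiMeasurePreserving.ae h
    change ∀ᵐ x : ℝ, (U + W : L2) (-x) = (U + W : L2) x
    filter_upwards [h, h', hU, hW] with x h1 h2 h3 h4
    rw [h1, h2, Pi.add_apply, Pi.add_apply, h3, h4]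
  smul_mem' := by
    intro c W hW
    have h := Lp.coeFn_smul c W
    have h' := (Measure.measurePreserving_neg (volume : Measure ℝ)).quasiMeasurePreserving.ae h
    change ∀ᵐ x : ℝ, (c • W : L2) (-x) = (c • W : L2) x
    filter_upwards [h, h', hW] with x h1 h2 h3
    rw [h1, h2, Pi.smul_apply, Pi.smul_apply, h3]

/-- The averaging operator `(A_η W)(x) = η⁻¹ ∫_{x-η/2}^{x+η/2} W(y) dy` on functions. -/
def avg (η : ℝ) (W : ℝ → ℝ) (x : ℝ) : ℝ :=
  η⁻¹ * ∫ y in (x - η / 2)..(x + η / 2), W y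

theorem avg_neg (η : ℝ) (W : ℝ → ℝ) : avg (-η) W = avg η W := by
  funext x
  unfold avg
  rw [intervalIntegral.integral_symm, neg_div, sub_neg_eq_add, ← sub_eq_add_neg, inv_neg]
  ring

theorem continuous_avg (η : ℝ) {W : ℝ → ℝ} (hW : LocallyIntegrable W) :
    Continuous (avg η W) := by
  have hi : ∀ a b : ℝ, IntervalIntegrable W volume a b := fun a b =>
    (hW.integrableOn_isCompact isCompact_uIcc).intervalIntegrable
  have hc := intervalIntegral.continuous_primitive hi 0
  have : avg η W = fun x => η⁻¹ * ((∫ y in (0 : ℝ)..(x + η / 2), W y)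
      - ∫ y in (0 : ℝ)..(x - η / 2), W y) := by
    funext x
    unfold avg
    rw [intervalIntegral.integral_interval_sub_left (hi _ _) (hi _ _)]
  rw [this]
  fun_prop

theorem abs_avg_le {W : ℝ → ℝ} {K : ℝ} (hK : ∀ x, |W x| ≤ K) (η x : ℝ) :
    |avg η W x| ≤ K := by
  have hK0 : 0 ≤ K := (abs_nonneg _).trans (hK 0)
  unfold avg
  have h := intervalIntegral.norm_integral_le_of_norm_le_const
    (a := x - η / 2) (b := x + η / 2) (f := W) (C := K) (fun y _ => hK y)
  rw [Real.norm_eq_abs, show x + η / 2 - (x - η / 2) = η by ring] at h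
  rw [abs_mul, abs_inv]
  rcases eq_or_ne η 0 with rfl | hη
  · simpa using hK0
  · have : 0 < |η| := abs_pos.mpr hη
    rw [inv_mul_le_iff₀ this]
    linarith

theorem sq_avg_le {η : ℝ} (hη : 0 < η) {W : ℝ → ℝ} (hW : LocallyIntegrable W)
    (hW2 : LocallyIntegrable fun x => W x ^ 2) (x : ℝ) :
    avg η W x ^ 2 ≤ avg η (fun y => W y ^ 2) x := by
  have hi : IntervalIntegrable W volume (x - η / 2) (x + η / 2) := (hW.integrableOn_isCompact isCompact_uIcc).intervalIntegrable
  have hi2 : IntervalIntegrable (fun y => W y ^ 2) volume (x - η / 2) (x + η / 2) :=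
    (hW2.integrableOn_isCompact isCompact_uIcc).intervalIntegrable
  set m := avg η W x with hm
  have h0 : 0 ≤ ∫ y in (x - η / 2)..(x + η / 2), (W y - m) ^ 2 :=
    intervalIntegral.integral_nonneg (by linarith) (fun y _ => sq_nonneg _)
  have h1 : (∫ y in (x - η / 2)..(x + η / 2), (W y - m) ^ 2)
      = (∫ y in (x - η / 2)..(x + η / 2), W y ^ 2)
        - (2 * m) * (∫ y in (x - η / 2)..(x + η / 2), W y) + η * m ^ 2 := by
    have e : (fun y => (W y - m) ^ 2) = fun y => (W y ^ 2 - (2 * m) * W y) + m ^ 2 := by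
      funext y; ring
    rw [e, intervalIntegral.integral_add (hi2.sub (hi.const_mul _)) intervalIntegrable_const,
      intervalIntegral.integral_sub hi2 (hi.const_mul _), intervalIntegral.integral_const_mul,
      intervalIntegral.integral_const]
    simp
  have h2 : (∫ y in (x - η / 2)..(x + η / 2), W y) = η * m := by
    rw [hm]; unfold avg; field_simp
  rw [h1, h2] at h0
  unfold avg
  rw [inv_mul_eq_div, le_div_iff₀ hη]
  nlinarith

theorem integrable_avg {η : ℝ} (hη : 0 < η) {f : ℝ → ℝ} (hf : Integrable f) :
    Integrable (avg η f) := by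
  have hg : Integrable ((Ico (-(η / 2)) (η / 2)).indicator (fun _ : ℝ => (1 : ℝ))) :=
    (integrable_indicator_iff measurableSet_Ico).2 (by simp)
  have h := (hf.integrable_convolution (ContinuousLinearMap.mul ℝ ℝ) hg).const_mul η⁻¹
  refine h.congr (Eventually.of_forall fun x => ?_)
  simp only [avg, convolution, ContinuousLinearMap.mul_apply']
  congr 1
  rw [intervalIntegral.integral_of_le (by linarith), ← integral_indicator measurableSet_Ioc]
  congr 1
  funext t
  by_cases ht : t ∈ Ioc (x - η / 2) (x + η / 2)
  · have : x - t ∈ Ico (-(η / 2)) (η / 2) := ⟨by linarith [ht.2], by linarith [ht.1]⟩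
    simp [ht, this]
  · have : x - t ∉ Ico (-(η / 2)) (η / 2) := fun h =>
      ht ⟨by linarith [h.2], by linarith [h.1]⟩
    simp [ht, this]

theorem memLp_avg (η : ℝ) {W : ℝ → ℝ} (hW : MemLp W 2) : MemLp (avg η W) 2 := by
  have key : ∀ η : ℝ, 0 < η → MemLp (avg η W) 2 := by
    intro η hη
    have hl : LocallyIntegrable W := hW.locallyIntegrable (by norm_num)
    have h2 : Integrable fun x => W x ^ 2 := hW.integrable_sq
    have hc := continuous_avg η hl
    rw [memLp_two_iff_integrable_sq hc.aestronglyMeasurable]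
    refine (integrable_avg hη h2).mono' (hc.pow 2).aestronglyMeasurable
      (Eventually.of_forall fun x => ?_)
    rw [Real.norm_eq_abs, abs_of_nonneg (sq_nonneg _)]
    exact sq_avg_le hη hl h2.locallyIntegrable x
  rcases lt_trichotomy η 0 with h | h | h
  · rw [← avg_neg]; exact key (-η) (by linarith)
  · subst h
    have : avg 0 W = 0 := by funext x; simp [avg]
    rw [this]; exact MemLp.zero
  · exact key η h

/-- The averaging operator `A_η` on `L²(ℝ)`. -/
def opA (η : ℝ) (W : L2) : L2 := (memLp_avg η (Lp.memLp W)).toLp (avg η W)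

/-- The constant `d₁` of the limiting KdV travelling wave equation `W'' = d₁ W - d₂ W²`. -/
def d₁ (α : ℝ → ℝ) : ℝ := 12 / ∫ ξ in Ioi (0 : ℝ), α ξ * ξ ^ 4

/-- The constant `d₂` of the limiting KdV travelling wave equation `W'' = d₁ W - d₂ W²`. -/
def d₂ (α β : ℝ → ℝ) : ℝ :=
  12 * (∫ ξ in Ioi (0 : ℝ), β ξ * ξ ^ 3) / ∫ ξ in Ioi (0 : ℝ), α ξ * ξ ^ 4

/-- The KdV wave `W₀(x) = (3 d₁ / (2 d₂)) sech²(√d₁ x / 2)`. -/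
def W₀ (α β : ℝ → ℝ) (x : ℝ) : ℝ :=
  3 * d₁ α / (2 * d₂ α β) * (1 / Real.cosh (1 / 2 * √(d₁ α) * x)) ^ 2

theorem continuous_W₀ (α β : ℝ → ℝ) : Continuous (W₀ α β) := by
  unfold W₀
  have : ∀ x : ℝ, Real.cosh (1 / 2 * √(d₁ α) * x) ≠ 0 := fun x => (Real.cosh_pos _).ne'
  fun_prop (disch := assumption)

theorem abs_W₀_le (α β : ℝ → ℝ) (x : ℝ) : |W₀ α β x| ≤ |3 * d₁ α / (2 * d₂ α β)| := by
  unfold W₀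
  rw [abs_mul]
  refine mul_le_of_le_one_right (abs_nonneg _) ?_
  have h1 := Real.one_le_cosh (1 / 2 * √(d₁ α) * x)
  rw [abs_of_nonneg (by positivity)]
  have h2 : 1 / Real.cosh (1 / 2 * √(d₁ α) * x) ≤ 1 := by
    rw [div_le_one (by linarith)]; exact h1
  exact pow_le_one₀ (by positivity) h2

theorem memLp_avg_W₀_mul (α β : ℝ → ℝ) (η : ℝ) (V : L2) :
    MemLp (fun x => avg η (W₀ α β) x * avg η V x) 2 := by
  have h := memLp_avg η (Lp.memLp V)
  have hc := continuous_avg η (continuous_W₀ α β).locallyIntegrable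
  refine (h.const_mul |3 * d₁ α / (2 * d₂ α β)|).mono
    (hc.aestronglyMeasurable.mul h.aestronglyMeasurable) (Eventually.of_forall fun x => ?_)
  simp only [norm_mul, Real.norm_eq_abs, abs_abs]
  exact mul_le_mul_of_nonneg_right (abs_avg_le (abs_W₀_le α β) η x) (abs_nonneg _)

/-- The product `(A_η W₀) (A_η V) ∈ L²(ℝ)`. -/
def avgProd (α β : ℝ → ℝ) (η : ℝ) (V : L2) : L2 :=
  (memLp_avg_W₀_mul α β η V).toLp (fun x => avg η (W₀ α β) x * avg η V x)

/-- The `L²(ℝ)`-valued integrand `ξ ↦ α(ξ) ξ² (W - A_{εξ}² W) / ε²`. -/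
def integrandB (α : ℝ → ℝ) (ε : ℝ) (W : L2) (ξ : ℝ) : L2 :=
  (α ξ * ξ ^ 2) • ((ε ^ 2)⁻¹ • (W - opA (ε * ξ) (opA (ε * ξ) W)))

/-- `B_ε W = W + ∫₀^∞ α(ξ) ξ² (W - A_{εξ}² W) / ε² dξ`, a Bochner integral in `L²(ℝ)`. -/
def opB (α : ℝ → ℝ) (ε : ℝ) (W : L2) : L2 :=
  W + ∫ ξ in Ioi (0 : ℝ), integrandB α ε W ξ

/-- The `L²(ℝ)`-valued integrand `ξ ↦ β(ξ) ξ³ A_{εξ}((A_{εξ} W₀) (A_{εξ} V))`. -/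
def integrandM (α β : ℝ → ℝ) (ε : ℝ) (V : L2) (ξ : ℝ) : L2 :=
  (β ξ * ξ ^ 3) • opA (ε * ξ) (avgProd α β (ε * ξ) V)

/-- `M_ε V = 2 ∫₀^∞ β(ξ) ξ³ A_{εξ}((A_{εξ} W₀) (A_{εξ} V)) dξ`, a Bochner integral in `L²(ℝ)`. -/
def opM (α β : ℝ → ℝ) (ε : ℝ) (V : L2) : L2 :=
  (2 : ℝ) • ∫ ξ in Ioi (0 : ℝ), integrandM α β ε V ξ

/-- The linearized operator `L_ε = B_ε - M_ε`. -/
def opL (α β : ℝ → ℝ) (ε : ℝ) (V : L2) : L2 := opB α ε V - opM α β ε V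

end PeridynamicKdV

end

open PeridynamicKdV

/-! `opL` is bounded, symmetric and preserves evenness, so on the Hilbert space `L2even` everything
follows from one estimate `‖V‖ ≤ C * ‖opL α β ε V‖`, uniform in small `ε`
(`exists_equiv_of_symmetric_of_bounded_below`). The argument is quantitative, without compactness.

On the Fourier side `A_η` is multiplication by `sinc(πηk)` (`Φ_opA`), hence `B_ε` is multiplication
by a symbol `bsym ≥ 1`, and `B_ε⁻¹ L_ε V = V - B_ε⁻¹ M_ε V`. As `ε → 0` the formal limits are `B₀ =
1 - d₁⁻¹∂²` and `M₀ V = 2(∫βξ³) W₀ V`. Two operator norm estimates of order `ε` make this rigorous: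
`B_ε⁻¹ - B₀⁻¹ = O(ε)` (`exists_abs_inv_bsym_sub_le`) and `B₀⁻¹(M_ε - M₀) = O(ε)`
(`exists_norm_inv_bsym₀_opM_sub_le`). In the latter the smoothing by `B₀⁻¹` is essential, because
`A_η - 1` is small only at the expense of derivatives.

It remains to bound `V` by `V - B₀⁻¹ M₀ V` for even `V` (`norm_le_of_even`). With `c = √d₁/2`, the
function `u = B₀⁻¹ M₀ V` and the defect `f = V - u` satisfy `u'' = 4c²u - 12c² sech²(cx)(u + f)`.
The homogeneous equation has explicit solutions: an odd decaying one, proportional to `W₀'`, and an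
even growing one. Evenness of `u` excludes the former, and the two Wronskians of `u` with these
solutions give an exponential pointwise bound on `u` in terms of `f`, hence the `L²` bound. -/

noncomputable section

namespace PeridynamicKdV

open scoped FourierTransform SchwartzMap ENNReal

/-! ### Multiplication operators on `L²` -/

section Mult

variable {F : Type*} [NormedAddCommGroup F] [NormedSpace ℝ F]

/-- A bounded measurable real function on the line. -/
def BddMeas (m : ℝ → ℝ) : Prop := Measurable m ∧ ∃ C, ∀ x, |m x| ≤ C

theorem BddMeas.memLp_smul {m : ℝ → ℝ} (hm : BddMeas m) {f : ℝ → F}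
    (hf : MemLp f 2) : MemLp (fun x => m x • f x) 2 := by
  obtain ⟨hmeas, C, hC⟩ := hm
  refine (hf.norm.const_mul C).mono (hmeas.aestronglyMeasurable.smul hf.aestronglyMeasurable)
    (Eventually.of_forall fun x => ?_)
  rw [norm_smul, norm_mul, norm_norm]
  exact mul_le_mul_of_nonneg_right ((hC x).trans (le_abs_self C)) (norm_nonneg _)

/-- Multiplication by a bounded measurable real function, as an operator on `L²`. -/
def fmul (m : ℝ → ℝ) (hm : BddMeas m) :
    Lp F 2 (volume : Measure ℝ) →L[ℝ] Lp F 2 (volume : Measure ℝ) :=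
  LinearMap.mkContinuousOfExistsBound
    { toFun := fun f => (hm.memLp_smul (Lp.memLp f)).toLp _
      map_add' := fun f g => by
        rw [← MemLp.toLp_add]
        refine MemLp.toLp_congr _ _ ?_
        filter_upwards [Lp.coeFn_add f g] with x hx
        change m x • (f + g : Lp F 2 (volume : Measure ℝ)) x = m x • f x + m x • g x
        rw [hx, Pi.add_apply, smul_add]
      map_smul' := fun c f => by
        rw [RingHom.id_apply, ← MemLp.toLp_const_smul]
        refine MemLp.toLp_congr _ _ ?_
        filter_upwards [Lp.coeFn_smul c f] with x hx
        change m x • (c • f : Lp F 2 (volume : Measure ℝ)) x = c • m x • f x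
        rw [hx, Pi.smul_apply, smul_comm] } <| by
    obtain ⟨-, C, hC⟩ := id hm
    refine ⟨C, fun f => Lp.norm_le_mul_norm_of_ae_le_mul ?_⟩
    filter_upwards [(hm.memLp_smul (Lp.memLp f)).coeFn_toLp] with x hx
    change ‖((hm.memLp_smul (Lp.memLp f)).toLp _ : Lp F 2 (volume : Measure ℝ)) x‖ ≤ _
    rw [hx, norm_smul]
    exact mul_le_mul_of_nonneg_right (hC x) (norm_nonneg _)

theorem fmul_ae (m : ℝ → ℝ) (hm : BddMeas m) (f : Lp F 2 (volume : Measure ℝ)) :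
    ∀ᵐ x, fmul m hm f x = m x • f x := (hm.memLp_smul (Lp.memLp f)).coeFn_toLp

theorem norm_fmul_le {m : ℝ → ℝ} (hm : BddMeas m) {C : ℝ} (hC : ∀ x, |m x| ≤ C)
    (f : Lp F 2 (volume : Measure ℝ)) : ‖fmul m hm f‖ ≤ C * ‖f‖ := by
  refine Lp.norm_le_mul_norm_of_ae_le_mul ?_
  filter_upwards [fmul_ae m hm f] with x hx
  rw [hx, norm_smul]
  exact mul_le_mul_of_nonneg_right (hC x) (norm_nonneg _)

theorem BddMeas.of_continuous {m : ℝ → ℝ} (h : Continuous m) {C : ℝ} (hC : ∀ x, |m x| ≤ C) :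
    BddMeas m := ⟨h.measurable, C, hC⟩

end Mult

/-! ### The complex Fourier picture -/

/-- The complex Hilbert space `L²(ℝ, ℂ)`. -/
abbrev H2 : Type := Lp ℂ 2 (volume : Measure ℝ)

/-- Complexification `L²(ℝ, ℝ) → L²(ℝ, ℂ)`. -/
def iotaC : L2 →L[ℝ] H2 := Complex.ofRealCLM.compLpL 2 volume

theorem iotaC_ae (f : L2) : ∀ᵐ x, iotaC f x = (f x : ℂ) :=
  Complex.ofRealCLM.coeFn_compLpL f

theorem norm_iotaC (f : L2) : ‖iotaC f‖ = ‖f‖ := by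
  apply le_antisymm
  · refine Lp.norm_le_norm_of_ae_le ?_
    filter_upwards [iotaC_ae f] with x hx
    simp [hx]
  · refine Lp.norm_le_norm_of_ae_le ?_
    filter_upwards [iotaC_ae f] with x hx
    simp [hx]

/-- The Fourier transform of a real `L²` function. -/
def Φ : L2 →L[ℝ] H2 :=
  ((Lp.fourierTransformₗᵢ ℝ ℂ).toContinuousLinearEquiv.toContinuousLinearMap.restrictScalars ℝ).comp
    iotaC

theorem Φ_apply (f : L2) : Φ f = 𝓕 (iotaC f) := rfl

theorem norm_Φ (f : L2) : ‖Φ f‖ = ‖f‖ := by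
  rw [Φ_apply, Lp.norm_fourier_eq, norm_iotaC]

/-- The `L²` transform is defined by extension, the `L¹` transform by an integral. Both are tested
against smooth compactly supported functions, where the transform can be moved onto the test
function. -/
theorem fourier_ae_eq_of_integrable {v : H2} {h : ℝ → ℂ} (hv : v =ᵐ[volume] h)
    (hh : Integrable h) : (𝓕 v : H2) =ᵐ[volume] 𝓕 h := by
  have hc : Continuous (𝓕 h) := VectorFourier.fourierIntegral_continuous Real.continuous_fourierChar
    (by exact continuous_inner) hh
  refine ae_eq_of_integral_contDiff_smul_eq
    ((Lp.memLp (𝓕 v : H2)).locallyIntegrable (by norm_num)) hc.locallyIntegrable ?_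
  intro g hg hgc
  let φ : 𝓢(ℝ, ℂ) := HasCompactSupport.toSchwartzMap (f := fun x => (g x : ℂ))
    (hgc.comp_left (g := fun x : ℝ => (x : ℂ)) (by simp)) (Complex.ofRealCLM.contDiff.comp hg)
  have hφ : ∀ x, φ x = (g x : ℂ) := fun x => rfl
  have h1 := congrArg (fun T : TemperedDistribution ℝ ℂ => T φ)
    (Lp.fourier_toTemperedDistribution_eq v)
  simp only [TemperedDistribution.fourier_apply, Lp.toTemperedDistribution_apply] at h1
  have h2 : ∫ x, (𝓕 φ : 𝓢(ℝ, ℂ)) x • v x = ∫ x, φ x • 𝓕 h x := by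
    have := VectorFourier.integral_fourierIntegral_smul_eq_flip (μ := (volume : Measure ℝ))
      (ν := (volume : Measure ℝ)) (L := innerₗ ℝ) (f := (φ : ℝ → ℂ)) (g := h)
      Real.continuous_fourierChar continuous_inner φ.integrable hh
    rw [flip_innerₗ] at this
    refine Eq.trans (integral_congr_ae ?_) this
    filter_upwards [hv] with x hx
    rw [hx, SchwartzMap.fourier_coe]
    rfl
  rw [h2] at h1
  simp only [hφ] at h1
  simpa using h1.symm

/-- The symbol of the averaging operator. -/
def sy (η k : ℝ) : ℝ := Real.sinc (Real.pi * η * k)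

theorem abs_sy_le (η k : ℝ) : |sy η k| ≤ 1 := Real.abs_sinc_le_one _

theorem continuous_sy (η : ℝ) : Continuous (sy η) :=
  Real.continuous_sinc.comp (by fun_prop)

theorem bddMeas_sy (η : ℝ) : BddMeas (sy η) := .of_continuous (continuous_sy η) (abs_sy_le η)

/-- The window is `Ico` because `t ↦ x - t` reverses the half-open `Ioc` of the interval integral.
-/
theorem avg_eq_convolution {F : Type*} [NormedAddCommGroup F] [NormedSpace ℝ F] {η : ℝ}
    (hη : 0 < η) (f : ℝ → F) (x : ℝ) :
    (∫ y in (x - η / 2)..(x + η / 2), f y) =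
      ∫ t, (Ico (-(η / 2)) (η / 2)).indicator (fun _ : ℝ => (1 : ℝ)) t • f (x - t) := by
  have e := integral_sub_left_eq_self (μ := volume)
    (fun t => (Ico (-(η / 2)) (η / 2)).indicator (fun _ : ℝ => (1 : ℝ)) t • f (x - t)) x
  rw [← e, intervalIntegral.integral_of_le (by linarith), ← integral_indicator measurableSet_Ioc]
  congr 1
  funext t
  by_cases ht : t ∈ Ioc (x - η / 2) (x + η / 2)
  · have : x - t ∈ Ico (-(η / 2)) (η / 2) := ⟨by linarith [ht.2], by linarith [ht.1]⟩
    simp [ht, this]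
  · have : x - t ∉ Ico (-(η / 2)) (η / 2) := fun h =>
      ht ⟨by linarith [h.2], by linarith [h.1]⟩
    simp [ht, this]

theorem integral_avg {η : ℝ} (hη : 0 < η) {f : ℝ → ℝ} (hf : Integrable f) :
    ∫ x, avg η f x = ∫ x, f x := by
  have hg : Integrable ((Ico (-(η / 2)) (η / 2)).indicator (fun _ : ℝ => (1 : ℝ))) :=
    (integrable_indicator_iff measurableSet_Ico).2 (by simp)
  have h := integral_convolution (ContinuousLinearMap.mul ℝ ℝ) hg hf
  unfold avg
  rw [integral_const_mul]
  simp_rw [avg_eq_convolution hη]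
  have h' : (∫ x, ∫ t, (Ico (-(η / 2)) (η / 2)).indicator (fun _ : ℝ => (1 : ℝ)) t • f (x - t))
    = η * ∫ x, f x := by
    refine h.trans ?_
    rw [integral_indicator measurableSet_Ico]
    simp [hη.le]
  rw [h']
  field_simp

theorem opA_ae (η : ℝ) (W : L2) : opA η W =ᵐ[volume] avg η W := MemLp.coeFn_toLp _

theorem intervalIntegrable_L2 (W : L2) (a b : ℝ) : IntervalIntegrable W volume a b :=
  (((Lp.memLp W).locallyIntegrable (by norm_num)).integrableOn_isCompact
    isCompact_uIcc).intervalIntegrable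

theorem avg_congr {η : ℝ} {f g : ℝ → ℝ} (h : f =ᵐ[volume] g) : avg η f = avg η g := by
  funext x
  unfold avg
  rw [intervalIntegral.integral_congr_ae (h.mono fun y hy _ => hy)]

theorem opA_sub (η : ℝ) (V W : L2) : opA η (V - W) = opA η V - opA η W := by
  apply Lp.ext
  filter_upwards [opA_ae η (V - W), opA_ae η V, opA_ae η W, Lp.coeFn_sub (opA η V) (opA η W)]
    with x h1 h2 h3 h4
  rw [h1, h4, Pi.sub_apply, h2, h3, avg_congr (Lp.coeFn_sub V W)]
  unfold avg
  simp only [Pi.sub_apply]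
  rw [intervalIntegral.integral_sub (intervalIntegrable_L2 _ _ _) (intervalIntegrable_L2 _ _ _)]
  ring

theorem norm_sq_L2 (V : L2) : ‖V‖ ^ 2 = ∫ x, V x ^ 2 := by
  rw [← real_inner_self_eq_norm_sq, L2.inner_def]
  simp [sq]

/-- Jensen's inequality pointwise, then `integral_avg`. The Fourier symbol is deliberately not used:
the density argument for `Φ_opA` needs this continuity beforehand. -/
theorem norm_opA_le {η : ℝ} (hη : 0 < η) (V : L2) : ‖opA η V‖ ≤ ‖V‖ := by
  have hl : LocallyIntegrable V := (Lp.memLp V).locallyIntegrable (by norm_num)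
  have h2 : Integrable fun x => V x ^ 2 := (Lp.memLp V).integrable_sq
  refine le_of_sq_le_sq ?_ (norm_nonneg _)
  rw [norm_sq_L2, norm_sq_L2, ← integral_avg hη h2]
  refine integral_mono_ae (Lp.memLp (opA η V)).integrable_sq (integrable_avg hη h2) ?_
  filter_upwards [opA_ae η V] with x hx
  simp only [hx]
  exact sq_avg_le hη hl h2.locallyIntegrable x

theorem continuous_opA {η : ℝ} (hη : 0 < η) : Continuous (opA η) := by
  refine LipschitzWith.continuous (K := 1) (LipschitzWith.of_dist_le_mul fun V W => ?_)
  rw [dist_eq_norm, dist_eq_norm, ← opA_sub, NNReal.coe_one, one_mul]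
  exact norm_opA_le hη _

/-- Under the normalization `exp(-2πivk)` a window of width `η` produces the argument `πηk` of the
cardinal sine. -/
theorem fourier_indicator {η : ℝ} (hη : 0 < η) (k : ℝ) :
    𝓕 ((Ico (-(η / 2)) (η / 2)).indicator (fun _ : ℝ => (1 : ℂ))) k = η * sy η k := by
  rw [Real.fourier_real_eq_integral_exp_smul]
  have : (fun v : ℝ => Complex.exp (↑(-2 * Real.pi * v * k) * Complex.I) •
      (Ico (-(η / 2)) (η / 2)).indicator (fun _ : ℝ => (1 : ℂ)) v) =
      (Ico (-(η / 2)) (η / 2)).indicator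
        (fun v : ℝ => Complex.exp ((-2 * Real.pi * k * Complex.I) * v)) := by
    funext v
    by_cases hv : v ∈ Ico (-(η / 2)) (η / 2)
    · simp only [hv, indicator_of_mem, smul_eq_mul, mul_one]
      push_cast
      congr 1; ring
    · simp [hv]
  rw [this, integral_indicator measurableSet_Ico, integral_Ico_eq_integral_Ioc,
    ← intervalIntegral.integral_of_le (by linarith)]
  rcases eq_or_ne k 0 with rfl | hk
  · simp [sy]
  · have hc : (-2 * Real.pi * k * Complex.I : ℂ) ≠ 0 := by
      simp [Real.pi_ne_zero, hk]
    rw [integral_exp_mul_complex hc]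
    have hz : Real.pi * η * k ≠ 0 := by positivity
    rw [sy, Real.sinc_of_ne_zero hz]
    push_cast
    rw [Complex.sin]
    have hp : (Real.pi : ℂ) ≠ 0 := by exact_mod_cast Real.pi_ne_zero
    have hk' : (k : ℂ) ≠ 0 := by exact_mod_cast hk
    have hη' : (η : ℂ) ≠ 0 := by exact_mod_cast hη.ne'
    rw [show (-2 * Real.pi * k * Complex.I : ℂ) * (η / 2) = -(Real.pi * η * k) * Complex.I by ring,
      show (-2 * Real.pi * k * Complex.I : ℂ) * -(η / 2) = (Real.pi * η * k) * Complex.I by ring]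
    field_simp
    rw [Complex.I_sq]
    ring

/-- By density it suffices to treat Schwartz functions, for which the average is an `L¹` convolution
with the scaled indicator and the convolution theorem applies. -/
theorem Φ_opA {η : ℝ} (hη : 0 < η) (W : L2) : Φ (opA η W) = fmul (sy η) (bddMeas_sy η) (Φ W) := by
  refine DenseRange.induction_on
    (p := fun W : L2 => Φ (opA η W) = fmul (sy η) (bddMeas_sy η) (Φ W))
    (SchwartzMap.denseRange_toLpCLM (F := ℝ) (E := ℝ) (μ := volume) (p := 2) (by norm_num)) W
    ?_ ?_
  · exact isClosed_eq (Φ.continuous.comp (continuous_opA hη)) (by fun_prop)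
  intro f
  set W : L2 := SchwartzMap.toLpCLM ℝ ℝ 2 volume f with hW
  have hWf : W =ᵐ[volume] f := f.coeFn_toLp 2 volume
  have hf : Integrable f := f.integrable
  have e1 : (Φ W : H2) =ᵐ[volume] 𝓕 (fun x => (f x : ℂ)) := by
    refine fourier_ae_eq_of_integrable ?_ hf.ofReal
    filter_upwards [iotaC_ae W, hWf] with x h1 h2
    exact h1.trans (by rw [h2])
  have e2 : (Φ (opA η W) : H2) =ᵐ[volume] 𝓕 (fun x => (avg η f x : ℂ)) := by
    refine fourier_ae_eq_of_integrable ?_ (integrable_avg hη hf).ofReal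
    filter_upwards [iotaC_ae (opA η W), opA_ae η W] with x h1 h2
    exact h1.trans (by rw [h2, avg_congr hWf])
  have hg : Integrable ((Ico (-(η / 2)) (η / 2)).indicator (fun _ : ℝ => (1 : ℂ))) :=
    (integrable_indicator_iff measurableSet_Ico).2 (by simp)
  have e3 : (fun x => (avg η f x : ℂ)) = (η⁻¹ : ℂ) • convolution
      ((Ico (-(η / 2)) (η / 2)).indicator (fun _ : ℝ => (1 : ℂ))) (fun x => (f x : ℂ))
      (ContinuousLinearMap.mul ℂ ℂ) volume := by
    funext x
    simp only [Pi.smul_apply, convolution, ContinuousLinearMap.mul_apply', avg,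
      avg_eq_convolution hη, Complex.ofReal_mul, smul_eq_mul, Complex.ofReal_inv]
    congr 1
    rw [← integral_complex_ofReal]
    congr 1
    funext t
    by_cases ht : t ∈ Ico (-(η / 2)) (η / 2) <;> simp [ht]
  apply Lp.ext
  filter_upwards [e1, e2, fmul_ae (sy η) (bddMeas_sy η) (Φ W)] with k h1 h2 h3
  have hs := congrFun (VectorFourier.fourierIntegral_const_smul Real.fourierChar volume
    (innerₗ ℝ) (convolution ((Ico (-(η / 2)) (η / 2)).indicator (fun _ : ℝ => (1 : ℂ)))
      (fun x => (f x : ℂ)) (ContinuousLinearMap.mul ℂ ℂ) volume) (η⁻¹ : ℂ)) k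
  have := Real.fourier_mul_convolution_eq hg hf.ofReal k
  rw [h3, h1, h2, e3]
  refine hs.trans ?_
  rw [Pi.smul_apply]
  refine (congrArg (fun z => (η⁻¹ : ℂ) • z) this).trans ?_
  rw [fourier_indicator hη]
  have hη' : (η : ℂ) ≠ 0 := by exact_mod_cast hη.ne'
  simp only [smul_eq_mul, Complex.real_smul]
  field_simp
  rfl

/-! ### Linearity, symmetry and parity of the averaging operators -/

theorem opA_add (η : ℝ) (V W : L2) : opA η (V + W) = opA η V + opA η W := by
  apply Lp.ext
  filter_upwards [opA_ae η (V + W), opA_ae η V, opA_ae η W, Lp.coeFn_add (opA η V) (opA η W)]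
    with x h1 h2 h3 h4
  rw [h1, h4, Pi.add_apply, h2, h3, avg_congr (Lp.coeFn_add V W)]
  unfold avg
  simp only [Pi.add_apply]
  rw [intervalIntegral.integral_add (intervalIntegrable_L2 _ _ _) (intervalIntegrable_L2 _ _ _)]
  ring

theorem opA_smul (η c : ℝ) (V : L2) : opA η (c • V) = c • opA η V := by
  apply Lp.ext
  filter_upwards [opA_ae η (c • V), opA_ae η V, Lp.coeFn_smul c (opA η V)] with x h1 h2 h4
  rw [h1, h4, Pi.smul_apply, h2, avg_congr (Lp.coeFn_smul c V)]
  unfold avg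
  simp only [Pi.smul_apply, smul_eq_mul]
  rw [intervalIntegral.integral_const_mul]
  ring

theorem inner_fmul {𝕜 : Type*} [RCLike 𝕜] {m : ℝ → ℝ} (hm : BddMeas m)
    (v w : Lp 𝕜 2 (volume : Measure ℝ)) :
    inner 𝕜 (fmul m hm v) w = inner 𝕜 v (fmul m hm w) := by
  rw [L2.inner_def, L2.inner_def]
  refine integral_congr_ae ?_
  filter_upwards [fmul_ae m hm v, fmul_ae m hm w] with x h1 h2
  rw [h1, h2]
  simp only [RCLike.inner_apply, RCLike.real_smul_eq_coe_mul, map_mul, RCLike.conj_ofReal]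
  ring

theorem inner_Φ (V W : L2) : inner ℂ (Φ V) (Φ W) = (inner ℝ V W : ℂ) := by
  rw [Φ_apply, Φ_apply, Lp.inner_fourier_eq, L2.inner_def, L2.inner_def, ← integral_complex_ofReal]
  refine integral_congr_ae ?_
  filter_upwards [iotaC_ae V, iotaC_ae W] with x h1 h2
  rw [h1, h2]
  simp

/-- The symbol is real, so symmetry is read off on the Fourier side. -/
theorem inner_opA {η : ℝ} (hη : 0 < η) (V W : L2) :
    inner ℝ (opA η V) W = inner ℝ V (opA η W) := by
  have h : ((inner ℝ (opA η V) W : ℝ) : ℂ) = ((inner ℝ V (opA η W) : ℝ) : ℂ) := by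
    rw [← inner_Φ, ← inner_Φ, Φ_opA hη, Φ_opA hη, inner_fmul]
  exact_mod_cast h

theorem avg_even {η : ℝ} {W : ℝ → ℝ} (hW : ∀ᵐ x, W (-x) = W x) (x : ℝ) :
    avg η W (-x) = avg η W x := by
  have h : avg η W = avg η (fun x => W (-x)) := avg_congr (hW.mono fun x hx => hx.symm)
  conv_rhs => rw [h]
  unfold avg
  rw [intervalIntegral.integral_comp_neg]
  congr 2 <;> ring

theorem mem_L2even_iff {W : L2} : W ∈ L2even ↔ ∀ᵐ x : ℝ, W (-x) = W x := Iff.rfl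

theorem ae_neg {p : ℝ → Prop} (h : ∀ᵐ x, p x) : ∀ᵐ x : ℝ, p (-x) :=
  (Measure.measurePreserving_neg (volume : Measure ℝ)).quasiMeasurePreserving.ae h

theorem opA_mem_even (η : ℝ) {W : L2} (hW : W ∈ L2even) : opA η W ∈ L2even := by
  rw [mem_L2even_iff] at *
  filter_upwards [opA_ae η W, ae_neg (opA_ae η W)] with x h1 h2
  rw [h1, h2, avg_even hW]

theorem fmul_mem_even {m : ℝ → ℝ} (hm : BddMeas m) (he : ∀ x, m (-x) = m x) {W : L2}
    (hW : W ∈ L2even) : fmul m hm W ∈ L2even := by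
  rw [mem_L2even_iff] at *
  filter_upwards [fmul_ae m hm W, ae_neg (fmul_ae m hm W), hW] with x h1 h2 h3
  rw [h1, h2, he, h3]

/-- Reflection on `L²(ℝ)`. -/
def reflL2 : L2 →L[ℝ] L2 :=
  (Lp.compMeasurePreservingₗᵢ ℝ (fun x : ℝ => -x)
    (Measure.measurePreserving_neg (volume : Measure ℝ))).toContinuousLinearMap

theorem reflL2_ae (W : L2) : ∀ᵐ x, reflL2 W x = W (-x) :=
  Lp.coeFn_compMeasurePreserving W (Measure.measurePreserving_neg (volume : Measure ℝ))

theorem mem_L2even_iff_reflL2 {W : L2} : W ∈ L2even ↔ reflL2 W = W := by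
  rw [mem_L2even_iff]
  constructor
  · intro h
    apply Lp.ext
    filter_upwards [h, reflL2_ae W] with x h1 h2
    rw [h2, h1]
  · intro h
    filter_upwards [reflL2_ae W] with x h2
    rw [← h2, h]

theorem isClosed_L2even : IsClosed (L2even : Set L2) := by
  have : (L2even : Set L2) = {W | reflL2 W = W} := by
    ext W; exact mem_L2even_iff_reflL2
  rw [this]
  exact isClosed_eq reflL2.continuous continuous_id

instance : CompleteSpace L2even := isClosed_L2even.completeSpace_coe

/-! ### Superpositions of operators -/

/-- A family of linear operators on `L²(ℝ)`, strongly continuous and uniformly bounded in the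
parameter, symmetric and preserving evenness. -/
structure IsAdmissibleFamily (G : ℝ → L2 → L2) (C : ℝ) : Prop where
  add : ∀ ξ V W, G ξ (V + W) = G ξ V + G ξ W
  smul : ∀ ξ (c : ℝ) V, G ξ (c • V) = c • G ξ V
  cont : ∀ V, ContinuousOn (fun ξ => G ξ V) (Ioi 0)
  bound : ∀ ξ, 0 < ξ → ∀ V, ‖G ξ V‖ ≤ C * ‖V‖
  symm : ∀ ξ, 0 < ξ → ∀ V W, inner ℝ (G ξ V) W = inner ℝ V (G ξ W)
  even : ∀ ξ, 0 < ξ → ∀ V ∈ L2even, G ξ V ∈ L2even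

theorem integrableOn_smul {E : Type*} [NormedAddCommGroup E] [NormedSpace ℝ E] {h : ℝ → ℝ}
    (hh : IntegrableOn h (Ioi 0)) {G : ℝ → E} (hG : ContinuousOn G (Ioi 0)) {C : ℝ}
    (hC : ∀ ξ, 0 < ξ → ‖G ξ‖ ≤ C) : IntegrableOn (fun ξ => h ξ • G ξ) (Ioi 0) := by
  refine (hh.norm.const_mul C).mono'
    (hh.aestronglyMeasurable.smul (hG.aestronglyMeasurable measurableSet_Ioi)) ?_
  filter_upwards [ae_restrict_mem measurableSet_Ioi] with ξ hξ
  rw [norm_smul, mul_comm]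
  exact mul_le_mul_of_nonneg_right (hC ξ hξ) (norm_nonneg _)

theorem norm_integral_smul_le {E : Type*} [NormedAddCommGroup E] [NormedSpace ℝ E] {h : ℝ → ℝ}
    (hh : IntegrableOn h (Ioi 0)) {G : ℝ → E} {C : ℝ}
    (hC : ∀ ξ, 0 < ξ → ‖G ξ‖ ≤ C) :
    ‖∫ ξ in Ioi (0 : ℝ), h ξ • G ξ‖ ≤ (∫ ξ in Ioi (0 : ℝ), |h ξ|) * C := by
  rw [← integral_mul_const]
  refine norm_integral_le_of_norm_le (hh.norm.mul_const C) ?_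
  filter_upwards [ae_restrict_mem measurableSet_Ioi] with ξ hξ
  rw [norm_smul]
  exact mul_le_mul_of_nonneg_left (hC ξ hξ) (norm_nonneg _)

namespace IsAdmissibleFamily

variable {G : ℝ → L2 → L2} {C : ℝ} (hG : IsAdmissibleFamily G C) {h : ℝ → ℝ}
  (hh : IntegrableOn h (Ioi 0))

include hG hh

theorem integrableOn (V : L2) : IntegrableOn (fun ξ => h ξ • G ξ V) (Ioi 0) :=
  integrableOn_smul hh (hG.cont V) (fun ξ hξ => hG.bound ξ hξ V)

/-- Symmetry and evenness pass to the superposition because inner products and the reflection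
commute with the Bochner integral; the norm is at most `C ∫|h|`. -/
theorem exists_clm : ∃ T : L2 →L[ℝ] L2, (∀ V, T V = ∫ ξ in Ioi (0 : ℝ), h ξ • G ξ V) ∧
    (∀ V W, inner ℝ (T V) W = inner ℝ V (T W)) ∧ ∀ V ∈ L2even, T V ∈ L2even := by
  refine ⟨LinearMap.mkContinuous
    { toFun := fun V => ∫ ξ in Ioi (0 : ℝ), h ξ • G ξ V
      map_add' := fun V W => ?_
      map_smul' := fun c V => ?_ } ((∫ ξ in Ioi (0 : ℝ), |h ξ|) * C) (fun V => ?_),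
    fun V => rfl, fun V W => ?_, fun V hV => ?_⟩
  · rw [← integral_add (hG.integrableOn hh V) (hG.integrableOn hh W)]
    simp only [hG.add, smul_add]
  · rw [RingHom.id_apply, ← integral_smul]
    simp only [hG.smul, smul_comm c]
  · rw [mul_assoc]
    exact norm_integral_smul_le hh (fun ξ hξ => hG.bound ξ hξ V)
  · change inner ℝ (∫ ξ in Ioi (0 : ℝ), h ξ • G ξ V) W = inner ℝ V (∫ ξ in Ioi (0 : ℝ), h ξ • G ξ W)
    rw [← integral_inner (hG.integrableOn hh W), real_inner_comm,
      ← integral_inner (hG.integrableOn hh V)]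
    refine setIntegral_congr_fun measurableSet_Ioi fun ξ hξ => ?_
    simp only [inner_smul_right]
    rw [real_inner_comm, hG.symm ξ hξ]
  · change (∫ ξ in Ioi (0 : ℝ), h ξ • G ξ V) ∈ L2even
    rw [mem_L2even_iff_reflL2, ← reflL2.integral_comp_comm (hG.integrableOn hh V)]
    refine setIntegral_congr_fun measurableSet_Ioi fun ξ hξ => ?_
    simp only [map_smul]
    rw [mem_L2even_iff_reflL2.1 (hG.even ξ hξ V hV)]

end IsAdmissibleFamily

/-! ### Strong continuity -/

theorem norm_sq_H2 (v : H2) : ‖v‖ ^ 2 = ∫ x, ‖v x‖ ^ 2 := by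
  rw [← inner_self_eq_norm_sq (𝕜 := ℂ), L2.inner_def]
  simp only [inner_self_eq_norm_sq_to_K]
  norm_cast

/-- Dominated convergence; two symbols differ by at most 2, whence the majorant `4‖v‖²`. -/
theorem continuous_fmul_sy (v : H2) :
    Continuous fun η => fmul (sy η) (bddMeas_sy η) v := by
  rw [continuous_iff_continuousAt]
  intro η₀
  rw [ContinuousAt, tendsto_iff_norm_sub_tendsto_zero]
  have key : Tendsto (fun η => ∫ k, ((sy η k - sy η₀ k) ^ 2 * ‖v k‖ ^ 2)) (𝓝 η₀)
      (𝓝 (∫ k : ℝ, (0 : ℝ))) := by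
    have hv : Integrable fun k => ‖v k‖ ^ 2 := (Lp.memLp v).integrable_norm_pow (by norm_num)
    refine tendsto_integral_filter_of_dominated_convergence (fun k => 4 * ‖v k‖ ^ 2)
      (Eventually.of_forall fun η => ?_) (Eventually.of_forall fun η => Eventually.of_forall
        fun k => ?_) (hv.const_mul 4) (Eventually.of_forall fun k => ?_)
    · exact (((continuous_sy η).sub (continuous_sy η₀)).pow 2).aestronglyMeasurable.mul
        hv.aestronglyMeasurable
    · rw [Real.norm_eq_abs, abs_of_nonneg (by positivity)]
      gcongr
      have h1 := abs_le.1 (abs_sy_le η k)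
      have h2 := abs_le.1 (abs_sy_le η₀ k)
      nlinarith [h1.1, h1.2, h2.1, h2.2]
    · have hc : Continuous fun η => (sy η k - sy η₀ k) ^ 2 * ‖v k‖ ^ 2 := by
        have : Continuous fun η => sy η k := Real.continuous_sinc.comp (by fun_prop)
        fun_prop
      have := hc.tendsto η₀
      simpa using this
  rw [integral_zero] at key
  have := (Real.continuous_sqrt.tendsto 0).comp key
  rw [Real.sqrt_zero] at this
  refine this.congr fun η => ?_
  rw [Function.comp, Real.sqrt_eq_iff_mul_self_eq (integral_nonneg fun k => by positivity)
    (norm_nonneg _), ← sq, norm_sq_H2]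
  refine integral_congr_ae ?_
  filter_upwards [fmul_ae (sy η) (bddMeas_sy η) v, fmul_ae (sy η₀) (bddMeas_sy η₀) v,
    Lp.coeFn_sub (fmul (sy η) (bddMeas_sy η) v) (fmul (sy η₀) (bddMeas_sy η₀) v)] with k h1 h2 h3
  rw [h3, Pi.sub_apply, h1, h2, ← sub_smul, norm_smul, mul_pow, Real.norm_eq_abs, sq_abs]

theorem isometry_Φ : Isometry Φ :=
  AddMonoidHomClass.isometry_of_norm Φ norm_Φ

theorem continuousOn_opA (V : L2) : ContinuousOn (fun η => opA η V) (Ioi 0) := by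
  rw [isometry_Φ.isUniformInducing.isInducing.continuousOn_iff]
  refine (continuous_fmul_sy (Φ V)).continuousOn.congr fun η hη => ?_
  exact Φ_opA hη V

/-- Contractivity of `opA η` absorbs the variation of its argument, leaving strong continuity at a
fixed vector. -/
theorem continuousOn_opA_comp {G : ℝ → L2} (hG : ContinuousOn G (Ioi 0)) :
    ContinuousOn (fun η => opA η (G η)) (Ioi 0) := by
  intro η₀ hη₀
  have h1 : Tendsto (fun η => opA η (G η₀)) (𝓝[Ioi 0] η₀) (𝓝 (opA η₀ (G η₀))) :=
    continuousOn_opA (G η₀) η₀ hη₀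
  have h2 : Tendsto (fun η => opA η (G η - G η₀)) (𝓝[Ioi 0] η₀) (𝓝 0) := by
    have : Tendsto (fun η => ‖G η - G η₀‖) (𝓝[Ioi 0] η₀) (𝓝 0) :=
      tendsto_iff_norm_sub_tendsto_zero.1 (hG η₀ hη₀)
    refine squeeze_zero_norm' ?_ this
    filter_upwards [self_mem_nhdsWithin] with η hη
    exact norm_opA_le hη _
  have := h2.add h1
  rw [zero_add] at this
  refine this.congr fun η => ?_
  rw [← opA_add, sub_add_cancel]

/-! ### Averages of Lipschitz functions -/

/-- Rescaling to a fixed window moves the dependence on `η` into the integrand, where a Lipschitz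
bound can act. -/
theorem avg_eq_integral_comp {η : ℝ} (hη : 0 < η) (W : ℝ → ℝ) (x : ℝ) :
    avg η W x = ∫ s in (-(1 / 2) : ℝ)..(1 / 2), W (x + η * s) := by
  rw [intervalIntegral.integral_comp_add_mul W hη.ne']
  unfold avg
  rw [smul_eq_mul]
  congr 2 <;> ring

theorem abs_avg_sub_avg_le {W : ℝ → ℝ} (hc : Continuous W) {L : ℝ}
    (hL : ∀ x y, |W x - W y| ≤ L * |x - y|) {η η' : ℝ} (hη : 0 < η) (hη' : 0 < η') (x : ℝ) :
    |avg η W x - avg η' W x| ≤ L * |η - η'| := by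
  have hL0 : 0 ≤ L := by simpa using (abs_nonneg _).trans (hL 1 0)
  rw [avg_eq_integral_comp hη, avg_eq_integral_comp hη', ← intervalIntegral.integral_sub
    (Continuous.intervalIntegrable (by fun_prop) _ _)
    (Continuous.intervalIntegrable (by fun_prop) _ _)]
  have h := intervalIntegral.norm_integral_le_of_norm_le_const (a := -(1 / 2)) (b := 1 / 2)
    (f := fun s => W (x + η * s) - W (x + η' * s)) (C := L * |η - η'|) (fun s hs => ?_)
  · rw [Real.norm_eq_abs] at h
    norm_num at h
    exact h
  · rw [uIoc_of_le (by norm_num)] at hs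
    rw [Real.norm_eq_abs]
    refine (hL _ _).trans ?_
    have hs1 : |s| ≤ 1 := abs_le.2 ⟨by linarith [hs.1], by linarith [hs.2]⟩
    rw [show x + η * s - (x + η' * s) = (η - η') * s by ring, abs_mul]
    have := mul_le_of_le_one_right (abs_nonneg (η - η')) hs1
    gcongr

theorem abs_avg_sub_le {W : ℝ → ℝ} (hc : Continuous W) {L : ℝ}
    (hL : ∀ x y, |W x - W y| ≤ L * |x - y|) {η : ℝ} (hη : 0 < η) {x y : ℝ}
    (hxy : |x - y| ≤ η / 2) : |avg η W x - W y| ≤ L * η := by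
  have hL0 : 0 ≤ L := by simpa using (abs_nonneg _).trans (hL 1 0)
  have e : avg η W x - W y = ∫ s in (-(1 / 2) : ℝ)..(1 / 2), (W (x + η * s) - W y) := by
    rw [avg_eq_integral_comp hη, intervalIntegral.integral_sub
      (Continuous.intervalIntegrable (by fun_prop) _ _) intervalIntegrable_const]
    norm_num
  rw [e]
  have h := intervalIntegral.norm_integral_le_of_norm_le_const (a := -(1 / 2)) (b := 1 / 2)
    (f := fun s => W (x + η * s) - W y) (C := L * η) (fun s hs => ?_)
  · rw [Real.norm_eq_abs] at h
    norm_num at h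
    exact h
  · rw [uIoc_of_le (by norm_num)] at hs
    rw [Real.norm_eq_abs]
    refine (hL _ _).trans ?_
    have : |x + η * s - y| ≤ η := by
      obtain ⟨h1, h2⟩ := abs_le.1 hxy
      exact abs_le.2 ⟨by nlinarith [hs.1], by nlinarith [hs.2]⟩
    gcongr

theorem hasDerivAt_sech_sq (c x : ℝ) :
    HasDerivAt (fun x => (1 / Real.cosh (c * x)) ^ 2)
      (-(2 * c * (Real.sinh (c * x) / Real.cosh (c * x) ^ 3))) x := by
  have hc := (Real.cosh_pos (c * x)).ne'
  have h1 : HasDerivAt (fun x => Real.cosh (c * x)) (Real.sinh (c * x) * c) x := by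
    simpa using ((hasDerivAt_id x).const_mul c).cosh
  have h2 := ((hasDerivAt_const x (1 : ℝ)).div h1 hc).pow 2
  refine h2.congr_deriv ?_
  simp only [Pi.div_apply, Nat.cast_ofNat]
  field_simp
  norm_num
  field_simp

theorem sinh_div_cosh_le (x : ℝ) : |Real.sinh x / Real.cosh x| ≤ 1 := by
  rw [abs_div, abs_of_pos (Real.cosh_pos x), div_le_one (Real.cosh_pos x), abs_le]
  have h1 := Real.cosh_add_sinh x
  have h2 := Real.cosh_sub_sinh x
  constructor <;> nlinarith [Real.exp_pos x, Real.exp_pos (-x)]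

theorem exists_lipschitz_W₀ (α β : ℝ → ℝ) : ∃ L, ∀ x y, |W₀ α β x - W₀ α β y| ≤ L * |x - y| := by
  set K := 3 * d₁ α / (2 * d₂ α β)
  set c := 1 / 2 * √(d₁ α)
  refine ⟨|K| * (2 * |c|), fun x y => ?_⟩
  have hd : ∀ z, HasDerivAt (W₀ α β) (K * (-(2 * c * (Real.sinh (c * z) / Real.cosh (c * z) ^ 3)))) z :=
    fun z => (hasDerivAt_sech_sq c z).const_mul K
  clear_value K c
  refine (convex_univ (E := ℝ) (𝕜 := ℝ)).norm_image_sub_le_of_norm_hasDerivWithin_le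
    (f := W₀ α β) (fun z _ => (hd z).hasDerivWithinAt) (fun z _ => ?_) (mem_univ y) (mem_univ x)
  have h1 := Real.one_le_cosh (c * z)
  have h2 := sinh_div_cosh_le (c * z)
  have e : Real.sinh (c * z) / Real.cosh (c * z) ^ 3
    = (Real.sinh (c * z) / Real.cosh (c * z)) * (1 / Real.cosh (c * z) ^ 2) := by
    field_simp
  have h3 : |1 / Real.cosh (c * z) ^ 2| ≤ 1 := by
    rw [abs_of_nonneg (by positivity), div_le_one (by positivity)]
    nlinarith
  rw [Real.norm_eq_abs, abs_mul, abs_neg, abs_mul, abs_mul 2, e, abs_mul (_ / _), abs_two]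
  have := mul_le_one₀ h2 (abs_nonneg _) h3
  have h4 := mul_le_of_le_one_right (by positivity : 0 ≤ 2 * |c|) this
  exact mul_le_mul_of_nonneg_left h4 (abs_nonneg _)

theorem W₀_neg (α β : ℝ → ℝ) (x : ℝ) : W₀ α β (-x) = W₀ α β x := by
  unfold W₀
  rw [mul_neg, Real.cosh_neg]

/-! ### The linear and the quadratic part as superpositions -/

theorem bddMeas_avg_W₀ (α β : ℝ → ℝ) (η : ℝ) : BddMeas (avg η (W₀ α β)) :=
  .of_continuous (continuous_avg η (continuous_W₀ α β).locallyIntegrable)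
    (abs_avg_le (abs_W₀_le α β) η)

theorem avgProd_eq (α β : ℝ → ℝ) (η : ℝ) (V : L2) :
    avgProd α β η V = fmul (avg η (W₀ α β)) (bddMeas_avg_W₀ α β η) (opA η V) := by
  apply Lp.ext
  filter_upwards [(memLp_avg_W₀_mul α β η V).coeFn_toLp,
    fmul_ae (avg η (W₀ α β)) (bddMeas_avg_W₀ α β η) (opA η V), opA_ae η V] with x h1 h2 h3
  rw [h2, h3]
  exact h1

theorem norm_avgProd_le (α β : ℝ → ℝ) {η : ℝ} (hη : 0 < η) (V : L2) :
    ‖avgProd α β η V‖ ≤ |3 * d₁ α / (2 * d₂ α β)| * ‖V‖ := by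
  rw [avgProd_eq]
  refine (norm_fmul_le _ (abs_avg_le (abs_W₀_le α β) η) _).trans ?_
  have := norm_opA_le hη V
  gcongr

theorem continuousOn_avgProd (α β : ℝ → ℝ) (V : L2) :
    ContinuousOn (fun η => avgProd α β η V) (Ioi 0) := by
  intro η₀ hη₀
  rw [ContinuousWithinAt, tendsto_iff_norm_sub_tendsto_zero]
  obtain ⟨L, hL⟩ := exists_lipschitz_W₀ α β
  set K := |3 * d₁ α / (2 * d₂ α β)|
  have h1 : Tendsto (fun η => ‖opA η V - opA η₀ V‖) (𝓝[Ioi 0] η₀) (𝓝 0) :=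
    tendsto_iff_norm_sub_tendsto_zero.1 (continuousOn_opA V η₀ hη₀)
  have h2 : Tendsto (fun η => L * |η - η₀| * ‖V‖) (𝓝[Ioi 0] η₀) (𝓝 0) := by
    have : Continuous (fun η => L * |η - η₀| * ‖V‖) := by fun_prop
    have := this.tendsto η₀
    simp only [sub_self, abs_zero, mul_zero, zero_mul] at this
    exact this.mono_left nhdsWithin_le_nhds
  have h3 := (h1.const_mul K).add h2
  rw [mul_zero, zero_add] at h3
  refine squeeze_zero' (Eventually.of_forall fun _ => norm_nonneg _) ?_ h3
  filter_upwards [self_mem_nhdsWithin] with η hη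
  have hd : BddMeas (fun x => avg η (W₀ α β) x - avg η₀ (W₀ α β) x) :=
    ⟨(bddMeas_avg_W₀ α β η).1.sub (bddMeas_avg_W₀ α β η₀).1, _,
      abs_avg_sub_avg_le (continuous_W₀ α β) hL hη hη₀⟩
  -- The multiplier varies continuously in the sup norm, since `W₀` is Lipschitz, whereas `opA η V`
  -- is only used through its strong continuity.
  have e : avgProd α β η V - avgProd α β η₀ V
      = fmul (avg η (W₀ α β)) (bddMeas_avg_W₀ α β η) (opA η V - opA η₀ V)
        + fmul _ hd (opA η₀ V) := by
    rw [avgProd_eq, avgProd_eq, map_sub]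
    have : fmul _ hd (opA η₀ V) = fmul (avg η (W₀ α β)) (bddMeas_avg_W₀ α β η) (opA η₀ V)
        - fmul (avg η₀ (W₀ α β)) (bddMeas_avg_W₀ α β η₀) (opA η₀ V) := by
      apply Lp.ext
      filter_upwards [fmul_ae _ hd (opA η₀ V),
        fmul_ae _ (bddMeas_avg_W₀ α β η) (opA η₀ V),
        fmul_ae _ (bddMeas_avg_W₀ α β η₀) (opA η₀ V),
        Lp.coeFn_sub (fmul (avg η (W₀ α β)) (bddMeas_avg_W₀ α β η) (opA η₀ V))
          (fmul (avg η₀ (W₀ α β)) (bddMeas_avg_W₀ α β η₀) (opA η₀ V))] with x h1 h2 h3 h4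
      rw [h4, Pi.sub_apply, h1, h2, h3, sub_smul]
    rw [this]
    abel
  rw [e]
  refine (norm_add_le _ _).trans (add_le_add ?_ ?_)
  · exact norm_fmul_le _ (abs_avg_le (abs_W₀_le α β) η) _
  · refine (norm_fmul_le _ (abs_avg_sub_avg_le (continuous_W₀ α β) hL hη hη₀) _).trans ?_
    have hL0 : 0 ≤ L := by simpa using (abs_nonneg _).trans (hL 1 0)
    have := norm_opA_le hη₀ V
    gcongr

theorem mapsTo_mul_Ioi {ε : ℝ} (hε : 0 < ε) : MapsTo (fun ξ => ε * ξ) (Ioi 0) (Ioi 0) :=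
  fun _ hξ => mul_pos hε hξ

theorem isAdmissibleFamily_M (α β : ℝ → ℝ) {ε : ℝ} (hε : 0 < ε) :
    IsAdmissibleFamily (fun ξ V => opA (ε * ξ) (avgProd α β (ε * ξ) V))
      |3 * d₁ α / (2 * d₂ α β)| where
  add ξ V W := by simp only [avgProd_eq, opA_add, map_add]
  smul ξ c V := by simp only [avgProd_eq, opA_smul, map_smul]
  cont V := (continuousOn_opA_comp (continuousOn_avgProd α β V)).comp
    (by fun_prop) (mapsTo_mul_Ioi hε)
  bound ξ hξ V := (norm_opA_le (mul_pos hε hξ) _).trans (norm_avgProd_le α β (mul_pos hε hξ) V)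
  symm ξ hξ V W := by
    have := mul_pos hε hξ
    rw [inner_opA this, avgProd_eq, avgProd_eq, inner_fmul, inner_opA this]
  even ξ hξ V hV := by
    refine opA_mem_even _ ?_
    rw [avgProd_eq]
    exact fmul_mem_even _ (avg_even (Eventually.of_forall (W₀_neg α β))) (opA_mem_even _ hV)

/-- The bound degenerates as `ε → 0`. This is harmless: it serves only to define the operator at
fixed `ε`, and uniform estimates come from the symbol. -/
theorem isAdmissibleFamily_B {ε : ℝ} (hε : 0 < ε) :
    IsAdmissibleFamily (fun ξ V => (ε ^ 2)⁻¹ • (V - opA (ε * ξ) (opA (ε * ξ) V)))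
      ((ε ^ 2)⁻¹ * 2) where
  add ξ V W := by
    simp only [opA_add]
    rw [← smul_add]
    congr 1
    abel
  smul ξ c V := by simp only [opA_smul]; rw [← smul_sub, smul_comm]
  cont V := by
    have hc : ContinuousOn (fun ξ => opA (ε * ξ) (opA (ε * ξ) V)) (Ioi 0) :=
      (continuousOn_opA_comp (continuousOn_opA V)).comp (by fun_prop) (mapsTo_mul_Ioi hε)
    exact ((continuousOn_const (c := V)).sub hc).const_smul ((ε ^ 2)⁻¹)
  bound ξ hξ V := by
    have h := mul_pos hε hξ
    rw [norm_smul, Real.norm_of_nonneg (by positivity), mul_assoc]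
    gcongr
    refine (norm_sub_le _ _).trans ?_
    linarith [(norm_opA_le h (opA (ε * ξ) V)).trans (norm_opA_le h V)]
  symm ξ hξ V W := by
    have h := mul_pos hε hξ
    rw [real_inner_smul_left, real_inner_smul_right, inner_sub_left, inner_sub_right,
      inner_opA h, inner_opA h]
  even ξ hξ V hV :=
    L2even.smul_mem _ (L2even.sub_mem hV (opA_mem_even _ (opA_mem_even _ hV)))

theorem PosFiniteMoment.integrableOn_pow {f : ℝ → ℝ} {n : ℕ} (h : PosFiniteMoment f n) :
    IntegrableOn (fun ξ => f ξ * ξ ^ n) (Ioi 0) := by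
  simpa only [Real.rpow_natCast] using h.1

theorem PosFiniteMoment.integral_pow_pos {f : ℝ → ℝ} {n : ℕ} (h : PosFiniteMoment f n) :
    0 < ∫ ξ in Ioi (0 : ℝ), f ξ * ξ ^ n := by
  simpa only [Real.rpow_natCast] using h.2

namespace Admissible

variable {α β : ℝ → ℝ} (h : Admissible α β)

include h

theorem α_two' : PosFiniteMoment α (2 : ℕ) := by exact_mod_cast h.α_two
theorem α_four' : PosFiniteMoment α (4 : ℕ) := by exact_mod_cast h.α_four
theorem α_six' : PosFiniteMoment α (6 : ℕ) := by exact_mod_cast h.α_six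
theorem β_three' : PosFiniteMoment β (3 : ℕ) := by exact_mod_cast h.β_three
theorem β_five' : PosFiniteMoment β (5 : ℕ) := by exact_mod_cast h.β_five

theorem d₁_pos : 0 < d₁ α := div_pos (by norm_num) h.α_four'.integral_pow_pos

theorem integrableOn_integrandB {ε : ℝ} (hε : 0 < ε) (V : L2) :
    IntegrableOn (integrandB α ε V) (Ioi 0) :=
  (isAdmissibleFamily_B hε).integrableOn h.α_two'.integrableOn_pow V

theorem integrableOn_integrandM {ε : ℝ} (hε : 0 < ε) (V : L2) :
    IntegrableOn (integrandM α β ε V) (Ioi 0) :=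
  (isAdmissibleFamily_M α β hε).integrableOn h.β_three'.integrableOn_pow V

theorem exists_opL_clm {ε : ℝ} (hε : 0 < ε) : ∃ T : L2 →L[ℝ] L2, (∀ V, T V = opL α β ε V) ∧
    (∀ V W, inner ℝ (T V) W = inner ℝ V (T W)) ∧ ∀ V ∈ L2even, T V ∈ L2even := by
  obtain ⟨B, hB, hBs, hBe⟩ := (isAdmissibleFamily_B hε).exists_clm h.α_two'.integrableOn_pow
  obtain ⟨M, hM, hMs, hMe⟩ := (isAdmissibleFamily_M α β hε).exists_clm h.β_three'.integrableOn_pow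
  refine ⟨ContinuousLinearMap.id ℝ L2 + B - (2 : ℝ) • M, fun V => ?_, fun V W => ?_, fun V hV => ?_⟩
  · have h1 : opB α ε V = V + B V := by rw [hB]; rfl
    have h2 : opM α β ε V = (2 : ℝ) • M V := by rw [hM]; rfl
    rw [opL, h1, h2]
    rfl
  · simp only [sub_apply, add_apply,
      smul_apply, ContinuousLinearMap.id_apply, inner_sub_left, inner_add_left,
      inner_sub_right, inner_add_right, real_inner_smul_left, real_inner_smul_right, hBs, hMs]
  · exact L2even.sub_mem (L2even.add_mem hV (hBe V hV)) (L2even.smul_mem _ (hMe V hV))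

end Admissible

/-- A bounded symmetric operator on a Hilbert space that is bounded below is an isomorphism. -/
theorem exists_equiv_of_symmetric_of_bounded_below {E : Type*} [NormedAddCommGroup E]
    [InnerProductSpace ℝ E] [CompleteSpace E] (T : E →L[ℝ] E)
    (hs : ∀ V W, inner ℝ (T V) W = inner ℝ V (T W)) {C : ℝ} (hb : ∀ V, ‖V‖ ≤ C * ‖T V‖) :
    ∃ e : E ≃L[ℝ] E, (∀ V, e V = T V) ∧ ∀ G, ‖e.symm G‖ ≤ C * ‖G‖ := by
  have hanti : AntilipschitzWith C.toNNReal T := by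
    refine T.antilipschitz_of_bound fun V => (hb V).trans ?_
    gcongr
    exact Real.le_coe_toNNReal C
  have hcl : IsClosed (T.range : Set E) := by
    rw [LinearMap.coe_range]
    exact hanti.isClosed_range T.uniformContinuous
  -- The range is closed by the lower bound. If `G` is orthogonal to it, then `⟨TG, TG⟩ = ⟨G, T(TG)⟩
  -- = 0`, and the lower bound forces `G = 0`.
  have hrange : T.range = ⊤ := by
    have : CompleteSpace T.range := hcl.completeSpace_coe
    rw [← Submodule.orthogonal_eq_bot_iff, Submodule.eq_bot_iff]
    intro G hG
    have h1 : T G = 0 := by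
      rw [← inner_self_eq_zero (𝕜 := ℝ), hs]
      rw [real_inner_comm]
      exact (Submodule.mem_orthogonal _ _).1 hG (T (T G)) ⟨T G, rfl⟩
    rw [← norm_le_zero_iff]
    simpa [h1] using hb G
  have hinj : T.ker = ⊥ := LinearMap.ker_eq_bot.2 hanti.injective
  refine ⟨ContinuousLinearEquiv.ofBijective T hinj hrange, fun V => rfl, fun G => ?_⟩
  have := hb ((ContinuousLinearEquiv.ofBijective T hinj hrange).symm G)
  have e : T ((ContinuousLinearEquiv.ofBijective T hinj hrange).symm G) = G :=
    (ContinuousLinearEquiv.ofBijective T hinj hrange).apply_symm_apply G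
  rwa [e] at this

/-! ### The symbol of the linear part -/

section Superposition

variable {h : ℝ → ℝ} (hh : IntegrableOn h (Ioi 0)) {m : ℝ → ℝ → ℝ}
  (hm : Continuous (Function.uncurry m)) {C : ℝ} (hC : ∀ ξ k, |m ξ k| ≤ C)

include hh hm hC

theorem continuous_superposition : Continuous fun k => ∫ ξ in Ioi (0 : ℝ), h ξ * m ξ k := by
  refine continuous_of_dominated (bound := fun ξ => |h ξ| * C) (fun k => ?_) (fun k => ?_)
    (hh.norm.mul_const C) ?_
  · exact hh.aestronglyMeasurable.mul
      (hm.comp (by fun_prop : Continuous fun ξ : ℝ => (ξ, k))).aestronglyMeasurable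
  · refine Eventually.of_forall fun ξ => ?_
    rw [Real.norm_eq_abs, abs_mul]
    exact mul_le_mul_of_nonneg_left (hC ξ k) (abs_nonneg _)
  · refine Eventually.of_forall fun ξ => continuous_const.mul ?_
    exact hm.comp (by fun_prop : Continuous fun k : ℝ => (ξ, k))

theorem bddMeas_superposition : BddMeas fun k => ∫ ξ in Ioi (0 : ℝ), h ξ * m ξ k :=
  .of_continuous (continuous_superposition hh hm hC) fun k =>
    norm_integral_smul_le (E := ℝ) hh (G := fun ξ => m ξ k) (fun ξ _ => hC ξ k)

theorem integrableOn_superposition (k : ℝ) : IntegrableOn (fun ξ => h ξ * m ξ k) (Ioi 0) :=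
  integrableOn_smul (E := ℝ) hh
    (hm.comp (by fun_prop : Continuous fun ξ : ℝ => (ξ, k))).continuousOn (fun ξ _ => hC ξ k)

/-- Pair with an arbitrary `w` and apply Fubini: `h` and the pointwise product of `w` and `v` are
integrable, and `m` is bounded and jointly continuous. -/
theorem integral_fmul (hb : ∀ ξ, BddMeas (m ξ)) (v : H2)
    (hi : IntegrableOn (fun ξ => h ξ • fmul (m ξ) (hb ξ) v) (Ioi 0)) :
    ∫ ξ in Ioi (0 : ℝ), h ξ • fmul (m ξ) (hb ξ) v =
      fmul _ (bddMeas_superposition hh hm hC) v := by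
  refine ext_inner_left ℂ fun w => ?_
  rw [← integral_inner hi]
  have hwv : Integrable fun k => inner ℂ (w k) (v k) := L2.integrable_inner w v
  have e1 : ∀ ξ, inner ℂ w (h ξ • fmul (m ξ) (hb ξ) v) =
      ∫ k, ((h ξ * m ξ k : ℝ) : ℂ) * inner ℂ (w k) (v k) := by
    intro ξ
    rw [L2.inner_def]
    refine integral_congr_ae ?_
    filter_upwards [Lp.coeFn_smul (h ξ) (fmul (m ξ) (hb ξ) v), fmul_ae (m ξ) (hb ξ) v] with k h1 h2
    rw [h1, Pi.smul_apply, h2]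
    simp only [RCLike.inner_apply, Complex.real_smul, Complex.ofReal_mul]
    ring
  have e2 : inner ℂ w (fmul _ (bddMeas_superposition hh hm hC) v) =
      ∫ k, ∫ ξ in Ioi (0 : ℝ), ((h ξ * m ξ k : ℝ) : ℂ) * inner ℂ (w k) (v k) := by
    rw [L2.inner_def]
    refine integral_congr_ae ?_
    filter_upwards [fmul_ae _ (bddMeas_superposition hh hm hC) v] with k h2
    rw [h2, integral_mul_const, integral_complex_ofReal]
    simp only [RCLike.inner_apply, Complex.real_smul]
    ring
  simp_rw [e1]
  rw [e2]
  refine integral_integral_swap ?_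
  have h3 : Integrable (fun p : ℝ × ℝ => (h p.1 : ℂ) * inner ℂ (w p.2) (v p.2))
      ((volume.restrict (Ioi 0)).prod volume) := Integrable.mul_prod hh.ofReal hwv
  have h4 := h3.bdd_mul (c := C) (f := fun p : ℝ × ℝ => ((m p.1 p.2 : ℝ) : ℂ))
    (by
      have : Continuous fun p : ℝ × ℝ => ((m p.1 p.2 : ℝ) : ℂ) :=
        Complex.continuous_ofReal.comp hm
      exact this.aestronglyMeasurable)
    (Eventually.of_forall fun p => by
      rw [Complex.norm_real]; exact hC _ _)
  refine h4.congr (Eventually.of_forall fun p => ?_)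
  simp only [Function.uncurry, Complex.ofReal_mul]
  ring

end Superposition

/-- The symbol of `(1 - A_{εξ}²) / ε²`. -/
def mB (ε ξ k : ℝ) : ℝ := (ε ^ 2)⁻¹ * (1 - sy (ε * ξ) k ^ 2)

theorem one_sub_sy_sq_nonneg (η k : ℝ) : 0 ≤ 1 - sy η k ^ 2 := by
  have := (sq_le_one_iff_abs_le_one _).2 (abs_sy_le η k)
  linarith

theorem abs_one_sub_sy_sq_le (η k : ℝ) : |1 - sy η k ^ 2| ≤ 1 := by
  rw [abs_of_nonneg (one_sub_sy_sq_nonneg η k)]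
  linarith [sq_nonneg (sy η k)]

theorem mB_nonneg (ε ξ k : ℝ) : 0 ≤ mB ε ξ k :=
  mul_nonneg (by positivity) (one_sub_sy_sq_nonneg _ _)

theorem abs_mB_le (ε ξ k : ℝ) : |mB ε ξ k| ≤ (ε ^ 2)⁻¹ := by
  unfold mB
  rw [abs_mul, abs_of_nonneg (by positivity : 0 ≤ (ε ^ 2)⁻¹)]
  exact mul_le_of_le_one_right (by positivity) (abs_one_sub_sy_sq_le _ _)

theorem continuous_mB (ε : ℝ) : Continuous (Function.uncurry (mB ε)) := by
  have : Continuous fun p : ℝ × ℝ => sy (ε * p.1) p.2 :=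
    Real.continuous_sinc.comp (by fun_prop)
  unfold Function.uncurry mB
  fun_prop

theorem bddMeas_mB (ε ξ : ℝ) : BddMeas (mB ε ξ) :=
  .of_continuous ((continuous_mB ε).comp (by fun_prop : Continuous fun k : ℝ => (ξ, k)))
    (abs_mB_le ε ξ)

/-- The symbol of `B_ε`. -/
def bsym (α : ℝ → ℝ) (ε k : ℝ) : ℝ := 1 + ∫ ξ in Ioi (0 : ℝ), (α ξ * ξ ^ 2) * mB ε ξ k

/-- The symbol of the limit operator `1 - d₁⁻¹ ∂²`. -/
def bsym₀ (α : ℝ → ℝ) (k : ℝ) : ℝ := 1 + (2 * Real.pi * k) ^ 2 / d₁ α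

theorem Φ_integrandB (α : ℝ → ℝ) {ε : ℝ} (hε : 0 < ε) (V : L2) {ξ : ℝ} (hξ : 0 < ξ) :
    Φ (integrandB α ε V ξ) = (α ξ * ξ ^ 2) • fmul (mB ε ξ) (bddMeas_mB ε ξ) (Φ V) := by
  have h := mul_pos hε hξ
  unfold integrandB
  rw [map_smul, map_smul, map_sub, Φ_opA h, Φ_opA h]
  congr 1
  set s := fmul (sy (ε * ξ)) (bddMeas_sy (ε * ξ)) (Φ V)
  set r := fmul (sy (ε * ξ)) (bddMeas_sy (ε * ξ)) s
  apply Lp.ext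
  filter_upwards [fmul_ae (mB ε ξ) (bddMeas_mB ε ξ) (Φ V),
    fmul_ae (sy (ε * ξ)) (bddMeas_sy (ε * ξ)) (Φ V), fmul_ae (sy (ε * ξ)) (bddMeas_sy (ε * ξ)) s,
    Lp.coeFn_sub (Φ V) r, Lp.coeFn_smul (ε ^ 2)⁻¹ (Φ V - r)] with k h1 h2 h3 h4 h5
  rw [h5, Pi.smul_apply, h4, Pi.sub_apply, h1, h3, h2]
  simp only [Complex.real_smul, mB]
  push_cast
  ring

namespace Admissible

variable {α β : ℝ → ℝ} (h : Admissible α β)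

include h

theorem α_moment_nonneg (n : ℕ) {ξ : ℝ} (hξ : 0 < ξ) : 0 ≤ α ξ * ξ ^ n :=
  mul_nonneg (h.α_nonneg ξ hξ) (by positivity)

theorem one_le_bsym (ε k : ℝ) : 1 ≤ bsym α ε k := by
  unfold bsym
  have : 0 ≤ ∫ ξ in Ioi (0 : ℝ), (α ξ * ξ ^ 2) * mB ε ξ k :=
    setIntegral_nonneg measurableSet_Ioi fun ξ hξ =>
      mul_nonneg (h.α_moment_nonneg 2 hξ) (mB_nonneg _ _ _)
  linarith

theorem continuous_bsym (ε : ℝ) : Continuous (bsym α ε) :=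
  continuous_const.add
    (continuous_superposition h.α_two'.integrableOn_pow (continuous_mB ε) (abs_mB_le ε))

theorem bddMeas_inv_bsym (ε : ℝ) : BddMeas fun k => (bsym α ε k)⁻¹ := by
  refine .of_continuous (C := 1) ((h.continuous_bsym ε).inv₀ fun k => ?_) fun k => ?_
  · linarith [h.one_le_bsym ε k]
  · have := h.one_le_bsym ε k
    rw [abs_of_nonneg (by positivity)]
    exact inv_le_one_of_one_le₀ this

theorem norm_fmul_inv_bsym_le (ε : ℝ) (v : H2) :
    ‖fmul _ (h.bddMeas_inv_bsym ε) v‖ ≤ ‖v‖ := by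
  have := norm_fmul_le (h.bddMeas_inv_bsym ε) (C := 1) (fun k => ?_) v
  · rwa [one_mul] at this
  · have := h.one_le_bsym ε k
    rw [abs_of_nonneg (by positivity)]
    exact inv_le_one_of_one_le₀ this

/-- `opB` is multiplication by `bsym` on the Fourier side. It is recorded through the inverse, which
is bounded by 1 uniformly in `ε`, while `bsym` itself need not be. -/
theorem fmul_inv_bsym_Φ_opB {ε : ℝ} (hε : 0 < ε) (V : L2) :
    fmul _ (h.bddMeas_inv_bsym ε) (Φ (opB α ε V)) = Φ V := by
  have hI := h.integrableOn_integrandB hε V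
  have e : Φ (opB α ε V) = Φ V + fmul _ (bddMeas_superposition h.α_two'.integrableOn_pow
      (continuous_mB ε) (abs_mB_le ε)) (Φ V) := by
    have hI2 : IntegrableOn (fun ξ => (α ξ * ξ ^ 2) • fmul (mB ε ξ) (bddMeas_mB ε ξ) (Φ V))
        (Ioi 0) := by
      refine IntegrableOn.congr_fun (Φ.integrable_comp hI) (fun ξ hξ => ?_) measurableSet_Ioi
      exact Φ_integrandB α hε V hξ
    rw [opB, map_add, ← Φ.integral_comp_comm hI,
      ← integral_fmul h.α_two'.integrableOn_pow (continuous_mB ε) (abs_mB_le ε) (bddMeas_mB ε)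
        (Φ V) hI2]
    congr 1
    exact setIntegral_congr_fun measurableSet_Ioi fun ξ hξ => Φ_integrandB α hε V hξ
  rw [e]
  set w := fmul _ (bddMeas_superposition h.α_two'.integrableOn_pow
      (continuous_mB ε) (abs_mB_le ε)) (Φ V) with hw
  apply Lp.ext
  filter_upwards [fmul_ae _ (h.bddMeas_inv_bsym ε) (Φ V + w), Lp.coeFn_add (Φ V) w,
    fmul_ae _ (bddMeas_superposition h.α_two'.integrableOn_pow (continuous_mB ε) (abs_mB_le ε))
      (Φ V)] with k h1 h2 h3
  rw [h1, h2, Pi.add_apply, hw, h3]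
  have hb : (1 + ∫ ξ in Ioi (0 : ℝ), (α ξ * ξ ^ 2) * mB ε ξ k) = bsym α ε k := rfl
  have hb0 : bsym α ε k ≠ 0 := by linarith [h.one_le_bsym ε k]
  conv_lhs => rw [← one_smul ℝ (Φ V k), smul_smul, mul_one, ← add_smul, hb, smul_smul,
    inv_mul_cancel₀ hb0, one_smul]

end Admissible

/-! ### Elementary estimates for the cardinal sine -/

theorem abs_sinc_sub_le {z : ℝ} (hz : |z| ≤ 1) :
    |Real.sinc z - (1 - z ^ 2 / 6)| ≤ |z| ^ 3 * (5 / 96) := by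
  rcases eq_or_ne z 0 with rfl | h0
  · simp
  have h := Real.sin_bound hz
  have hz0 : 0 < |z| := abs_pos.2 h0
  rw [Real.sinc_of_ne_zero h0]
  have e : Real.sin z / z - (1 - z ^ 2 / 6) = (Real.sin z - (z - z ^ 3 / 6)) / z := by
    field_simp
  rw [e, abs_div, div_le_iff₀ hz0]
  have h5 : |z| ^ 5 ≤ |z| ^ 3 * |z| := by
    rw [← pow_succ]; exact pow_le_pow_of_le_one (abs_nonneg _) hz (by norm_num)
  linarith [h, mul_nonneg (pow_nonneg (abs_nonneg z) 3) (abs_nonneg z)]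

theorem abs_one_sub_sinc_sq_le_one (z : ℝ) : |1 - Real.sinc z ^ 2| ≤ 1 := by
  have := abs_le.1 (Real.abs_sinc_le_one z)
  rw [abs_le]
  constructor <;> nlinarith [this.1, this.2]

/-- A cubic remainder is weaker than Taylor's quartic one, but it holds for all `z` and yields
exactly one power of `ε` after scaling. For `|z| ≥ 1` the terms are estimated separately. -/
theorem abs_one_sub_sinc_sq_sub_le (z : ℝ) :
    |1 - Real.sinc z ^ 2 - z ^ 2 / 3| ≤ 2 * |z| ^ 3 := by
  rcases le_total |z| 1 with hz | hz
  · set r := Real.sinc z - (1 - z ^ 2 / 6) with hr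
    have hb := abs_sinc_sub_le hz
    rw [← hr] at hb
    have e : 1 - Real.sinc z ^ 2 - z ^ 2 / 3 = -(z ^ 4 / 36) - r * (2 - z ^ 2 / 3 + r) := by
      rw [show Real.sinc z = r + (1 - z ^ 2 / 6) by rw [hr]; ring]
      ring
    have hz2 : z ^ 2 ≤ 1 := by rw [← sq_abs]; exact pow_le_one₀ (abs_nonneg _) hz
    have hz3 : |z| ^ 3 ≤ 1 := pow_le_one₀ (abs_nonneg _) hz
    have hz30 : 0 ≤ |z| ^ 3 := by positivity
    have hr1 := abs_le.1 hb
    have h1 : |2 - z ^ 2 / 3 + r| ≤ 3 := by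
      rw [abs_le]; constructor <;> nlinarith [sq_nonneg z]
    have h2 : |r * (2 - z ^ 2 / 3 + r)| ≤ |z| ^ 3 * (5 / 96) * 3 := by
      rw [abs_mul]; gcongr
    have h3 : |-(z ^ 4 / 36)| ≤ |z| ^ 3 := by
      rw [abs_neg, abs_div, abs_pow, pow_succ]
      have : |z| ^ 3 * |z| ≤ |z| ^ 3 := mul_le_of_le_one_right hz30 hz
      norm_num
      linarith
    rw [e]
    refine (abs_sub _ _).trans ?_
    linarith
  · have h1 := abs_one_sub_sinc_sq_le_one z
    have h3 : z ^ 2 ≤ |z| ^ 3 := by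
      rw [← sq_abs]; exact pow_le_pow_right₀ hz (by norm_num)
    have h4 : 1 ≤ |z| ^ 3 := one_le_pow₀ hz
    refine (abs_sub _ _).trans ?_
    rw [abs_of_nonneg (by positivity : 0 ≤ z ^ 2 / 3)]
    linarith

theorem one_sub_sinc_sq_le (z : ℝ) : 1 - Real.sinc z ^ 2 ≤ 3 * z ^ 2 := by
  rcases le_total |z| 1 with hz | hz
  · have h := (abs_le.1 (abs_one_sub_sinc_sq_sub_le z)).2
    have : |z| ^ 3 ≤ z ^ 2 := by
      rw [← sq_abs]; exact pow_le_pow_of_le_one (abs_nonneg _) hz (by norm_num)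
    linarith [sq_nonneg z]
  · have : 1 ≤ z ^ 2 := by rw [← sq_abs]; exact one_le_pow₀ hz
    linarith [sq_nonneg (Real.sinc z)]

theorem abs_sinc_le_abs_sinc_half (z : ℝ) : |Real.sinc z| ≤ |Real.sinc (z / 2)| := by
  rcases eq_or_ne z 0 with rfl | h0
  · simp
  have e : Real.sinc z = Real.sinc (z / 2) * Real.cos (z / 2) := by
    rw [Real.sinc_of_ne_zero h0, Real.sinc_of_ne_zero (by positivity)]
    have := Real.sin_two_mul (z / 2)
    rw [show 2 * (z / 2) = z by ring] at this
    rw [this]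
    field_simp
  rw [e, abs_mul]
  exact mul_le_of_le_one_right (abs_nonneg _) (Real.abs_cos_le_one _)

/-- The Taylor bound requires argument at most 1. Used at `z/2` it covers `|z| ≤ 2` and gives
`11/384 * z²`, which exceeds `z²/50`; beyond that range `|sinc z| ≤ 1/2`. -/
theorem le_one_sub_sinc_sq (z : ℝ) : 1 / 50 * min (z ^ 2) 1 ≤ 1 - Real.sinc z ^ 2 := by
  rcases le_total |z| 2 with hz | hz
  · have h1 := abs_sinc_le_abs_sinc_half z
    have hz2 : |z / 2| ≤ 1 := by rw [abs_div, abs_two]; linarith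
    have hb := abs_sinc_sub_le hz2
    have h3 : |z / 2| ^ 3 ≤ (z / 2) ^ 2 := by
      rw [← sq_abs]; exact pow_le_pow_of_le_one (abs_nonneg _) hz2 (by norm_num)
    have hz4 : (z / 2) ^ 2 ≤ 1 := by rw [← sq_abs]; exact pow_le_one₀ (abs_nonneg _) hz2
    have hb' := abs_le.1 hb
    have h4 : |Real.sinc (z / 2)| ≤ 1 - 11 / 96 * (z / 2) ^ 2 := by
      rw [abs_le]; constructor <;> linarith
    have h5 : Real.sinc z ^ 2 ≤ |Real.sinc z| := by
      rw [← sq_abs, sq]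
      exact mul_le_of_le_one_right (abs_nonneg _) (Real.abs_sinc_le_one z)
    have h6 : min (z ^ 2) 1 ≤ z ^ 2 := min_le_left _ _
    nlinarith [sq_nonneg z]
  · have h0 : z ≠ 0 := by rintro rfl; norm_num at hz
    have h1 : |Real.sinc z| ≤ 1 / 2 := by
      rw [Real.sinc_of_ne_zero h0, abs_div, div_le_iff₀ (by linarith)]
      linarith [Real.abs_sin_le_one z]
    have h2 : Real.sinc z ^ 2 ≤ 1 / 4 := by
      rw [← sq_abs]; nlinarith [abs_nonneg (Real.sinc z)]
    have h6 : min (z ^ 2) 1 ≤ 1 := min_le_right _ _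
    linarith

/-! ### Convergence of the symbols -/

/-- Interpolation of moments through `ξ ≤ 1 + ξ²`. -/
theorem integrableOn_mul_pow_succ {f : ℝ → ℝ} (hf : ∀ ξ, 0 < ξ → 0 ≤ f ξ) {n : ℕ}
    (h1 : IntegrableOn (fun ξ => f ξ * ξ ^ n) (Ioi 0))
    (h2 : IntegrableOn (fun ξ => f ξ * ξ ^ (n + 2)) (Ioi 0)) :
    IntegrableOn (fun ξ => f ξ * ξ ^ (n + 1)) (Ioi 0) := by
  refine (h1.add h2).mono' ?_ ?_
  · refine (h1.aestronglyMeasurable.mul continuous_id.aestronglyMeasurable).congr ?_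
    exact Eventually.of_forall fun ξ => by simp [pow_succ, mul_assoc]
  · filter_upwards [ae_restrict_mem measurableSet_Ioi] with ξ hξ
    have hξ0 : (0 : ℝ) < ξ := hξ
    have := mul_nonneg (hf ξ hξ) (pow_nonneg hξ0.le n)
    rw [Real.norm_of_nonneg (mul_nonneg (hf ξ hξ) (by positivity)), Pi.add_apply]
    have e1 : f ξ * ξ ^ (n + 1) = (f ξ * ξ ^ n) * ξ := by ring
    have e2 : f ξ * ξ ^ (n + 2) = (f ξ * ξ ^ n) * ξ ^ 2 := by ring
    rw [e1, e2]
    nlinarith [sq_nonneg (ξ - 1)]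

theorem mB_eq (ε ξ k : ℝ) :
    mB ε ξ k = (ε ^ 2)⁻¹ * (1 - Real.sinc (Real.pi * (ε * ξ) * k) ^ 2) := rfl

theorem abs_mB_sub_le {ε ξ : ℝ} (hε : 0 < ε) (hξ : 0 < ξ) (k : ℝ) :
    |mB ε ξ k - ξ ^ 2 * (Real.pi * k) ^ 2 / 3| ≤ 2 * Real.pi ^ 3 * ε * |k| ^ 3 * ξ ^ 3 := by
  have h := abs_one_sub_sinc_sq_sub_le (Real.pi * (ε * ξ) * k)
  have e : mB ε ξ k - ξ ^ 2 * (Real.pi * k) ^ 2 / 3 = (ε ^ 2)⁻¹ *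
      (1 - Real.sinc (Real.pi * (ε * ξ) * k) ^ 2 - (Real.pi * (ε * ξ) * k) ^ 2 / 3) := by
    rw [mB_eq]; field_simp
  rw [e, abs_mul, abs_of_nonneg (by positivity)]
  refine (mul_le_mul_of_nonneg_left h (by positivity)).trans (le_of_eq ?_)
  rw [abs_mul, abs_of_nonneg (by positivity : 0 ≤ Real.pi * (ε * ξ))]
  field_simp

theorem le_mB {ε ξ : ℝ} (hε : 0 < ε) (k : ℝ) :
    min (ξ ^ 2) 1 * (1 / 50 * min (k ^ 2) (ε ^ 2)⁻¹) ≤ mB ε ξ k := by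
  have h := le_one_sub_sinc_sq (Real.pi * (ε * ξ) * k)
  -- Splitting the truncation into a factor in `ξ` and a factor in `(ε, k)` lets the latter leave
  -- the integral over `ξ`.
  have hm : min (ξ ^ 2) 1 * min (ε ^ 2 * k ^ 2) 1 ≤ min ((Real.pi * (ε * ξ) * k) ^ 2) 1 := by
    have h1 : 0 ≤ min (ξ ^ 2) 1 := le_min (sq_nonneg _) zero_le_one
    have h2 : 0 ≤ min (ε ^ 2 * k ^ 2) 1 := le_min (by positivity) zero_le_one
    refine le_min ?_ (mul_le_one₀ (min_le_right _ _) h2 (min_le_right _ _))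
    refine (mul_le_mul (min_le_left _ _) (min_le_left _ _) h2 (sq_nonneg _)).trans ?_
    have e : (Real.pi * (ε * ξ) * k) ^ 2 = Real.pi ^ 2 * (ξ ^ 2 * (ε ^ 2 * k ^ 2)) := by ring
    rw [e]
    refine le_mul_of_one_le_left (by positivity) ?_
    exact one_le_pow₀ (by linarith [Real.pi_gt_three])
  have e : min (k ^ 2) (ε ^ 2)⁻¹ = (ε ^ 2)⁻¹ * min (ε ^ 2 * k ^ 2) 1 := by
    rw [mul_min_of_nonneg _ _ (by positivity)]
    congr 1 <;> field_simp
  rw [mB_eq, e]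
  calc _ = (ε ^ 2)⁻¹ * (1 / 50 * (min (ξ ^ 2) 1 * min (ε ^ 2 * k ^ 2) 1)) := by ring
    _ ≤ _ := by gcongr; exact (mul_le_mul_of_nonneg_left hm (by norm_num)).trans h

theorem continuous_bsym₀ (α : ℝ → ℝ) : Continuous (bsym₀ α) := by
  unfold bsym₀; fun_prop

theorem bsym₀_eq (α : ℝ → ℝ) (k : ℝ) :
    bsym₀ α k = 1 + k ^ 2 * (4 * Real.pi ^ 2 / d₁ α) := by
  unfold bsym₀; ring

namespace Admissible

variable {α β : ℝ → ℝ} (h : Admissible α β)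

include h

theorem integrableOn_α_five : IntegrableOn (fun ξ => α ξ * ξ ^ 5) (Ioi 0) :=
  integrableOn_mul_pow_succ h.α_nonneg h.α_four'.integrableOn_pow h.α_six'.integrableOn_pow

theorem integrableOn_β_four : IntegrableOn (fun ξ => β ξ * ξ ^ 4) (Ioi 0) :=
  integrableOn_mul_pow_succ h.β_nonneg h.β_three'.integrableOn_pow h.β_five'.integrableOn_pow

theorem integral_α_four : ∫ ξ in Ioi (0 : ℝ), α ξ * ξ ^ 4 = 12 / d₁ α := by
  have := h.α_four'.integral_pow_pos
  unfold d₁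
  field_simp

theorem abs_bsym_sub_le {ε : ℝ} (hε : 0 < ε) (k : ℝ) :
    |bsym α ε k - bsym₀ α k| ≤
      2 * Real.pi ^ 3 * (∫ ξ in Ioi (0 : ℝ), α ξ * ξ ^ 5) * ε * |k| ^ 3 := by
  have e0 : bsym₀ α k = 1 + ∫ ξ in Ioi (0 : ℝ), (α ξ * ξ ^ 4) * ((Real.pi * k) ^ 2 / 3) := by
    rw [integral_mul_const, h.integral_α_four, bsym₀]; ring
  have e : bsym α ε k - bsym₀ α k = ∫ ξ in Ioi (0 : ℝ),
      ((α ξ * ξ ^ 2) * mB ε ξ k - (α ξ * ξ ^ 4) * ((Real.pi * k) ^ 2 / 3)) := by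
    rw [e0, integral_sub (integrableOn_superposition h.α_two'.integrableOn_pow (continuous_mB ε)
      (abs_mB_le ε) k) (h.α_four'.integrableOn_pow.mul_const _), bsym]
    ring
  rw [e]
  have e2 : 2 * Real.pi ^ 3 * (∫ ξ in Ioi (0 : ℝ), α ξ * ξ ^ 5) * ε * |k| ^ 3 =
      ∫ ξ in Ioi (0 : ℝ), (α ξ * ξ ^ 5) * (2 * Real.pi ^ 3 * ε * |k| ^ 3) := by
    rw [integral_mul_const]; ring
  rw [e2]
  refine (Real.norm_eq_abs _).symm.le.trans
    (norm_integral_le_of_norm_le (h.integrableOn_α_five.mul_const _) ?_)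
  filter_upwards [ae_restrict_mem measurableSet_Ioi] with ξ hξ
  have hp := h.α_moment_nonneg 2 hξ
  have e3 : (α ξ * ξ ^ 2) * mB ε ξ k - (α ξ * ξ ^ 4) * ((Real.pi * k) ^ 2 / 3) =
      (α ξ * ξ ^ 2) * (mB ε ξ k - ξ ^ 2 * (Real.pi * k) ^ 2 / 3) := by ring
  rw [e3, Real.norm_eq_abs, abs_mul, abs_of_nonneg hp]
  refine (mul_le_mul_of_nonneg_left (abs_mB_sub_le hε hξ k) hp).trans (le_of_eq ?_)
  ring

/-- Integrating `le_mB` gives `q`. It is positive because the weight `min (ξ ^ 2) 1` vanishes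
nowhere on the half line, so `q = 0` would annihilate the second moment of `α`. -/
theorem exists_le_bsym : ∃ q, 0 < q ∧ ∀ ε, 0 < ε → ∀ k,
    1 + q * min (k ^ 2) (ε ^ 2)⁻¹ ≤ bsym α ε k := by
  have hmc : Continuous fun ξ : ℝ => min (ξ ^ 2) 1 := by fun_prop
  have hm1 : ∀ ξ : ℝ, |min (ξ ^ 2) 1| ≤ 1 := fun ξ => by
    rw [abs_of_nonneg (le_min (sq_nonneg _) zero_le_one)]; exact min_le_right _ _
  have hi : IntegrableOn (fun ξ => (α ξ * ξ ^ 2) * min (ξ ^ 2) 1) (Ioi 0) :=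
    integrableOn_smul (E := ℝ) h.α_two'.integrableOn_pow hmc.continuousOn (fun ξ _ => hm1 ξ)
  have hnn : ∀ ξ, 0 < ξ → 0 ≤ (α ξ * ξ ^ 2) * min (ξ ^ 2) 1 := fun ξ hξ =>
    mul_nonneg (h.α_moment_nonneg 2 hξ) (le_min (sq_nonneg _) zero_le_one)
  have hpos : 0 < ∫ ξ in Ioi (0 : ℝ), (α ξ * ξ ^ 2) * min (ξ ^ 2) 1 := by
    refine lt_of_le_of_ne (setIntegral_nonneg measurableSet_Ioi hnn) fun h0 => ?_
    have h1 := (setIntegral_eq_zero_iff_of_nonneg_ae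
      ((ae_restrict_mem measurableSet_Ioi).mono hnn) hi).1 h0.symm
    have h2 : ∫ ξ in Ioi (0 : ℝ), α ξ * ξ ^ 2 = 0 := by
      refine (integral_congr_ae (g := fun _ => (0 : ℝ)) ?_).trans (by simp)
      filter_upwards [h1, ae_restrict_mem measurableSet_Ioi] with ξ hξ hξ0
      have hξ0' : (0 : ℝ) < ξ := hξ0
      have : min (ξ ^ 2) 1 ≠ 0 := (lt_min (by positivity) one_pos).ne'
      simpa [this] using hξ
    exact h.α_two'.integral_pow_pos.ne' h2
  refine ⟨(∫ ξ in Ioi (0 : ℝ), (α ξ * ξ ^ 2) * min (ξ ^ 2) 1) * (1 / 50), by positivity,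
    fun ε hε k => ?_⟩
  unfold bsym
  rw [add_le_add_iff_left, mul_assoc, ← integral_mul_const]
  refine setIntegral_mono_on (hi.mul_const _)
    (integrableOn_superposition h.α_two'.integrableOn_pow (continuous_mB ε) (abs_mB_le ε) k)
    measurableSet_Ioi fun ξ hξ => ?_
  rw [mul_assoc]
  exact mul_le_mul_of_nonneg_left (le_mB hε k) (h.α_moment_nonneg 2 hξ)

theorem one_le_bsym₀ (k : ℝ) : 1 ≤ bsym₀ α k := by
  have := h.d₁_pos
  rw [bsym₀]
  have : 0 ≤ (2 * Real.pi * k) ^ 2 / d₁ α := by positivity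
  linarith

theorem abs_inv_bsym₀_le (k : ℝ) : |(bsym₀ α k)⁻¹| ≤ 1 := by
  have := h.one_le_bsym₀ k
  rw [abs_of_nonneg (by positivity)]
  exact inv_le_one_of_one_le₀ this

theorem bddMeas_inv_bsym₀ : BddMeas fun k => (bsym₀ α k)⁻¹ :=
  .of_continuous ((continuous_bsym₀ α).inv₀ fun k => by linarith [h.one_le_bsym₀ k])
    h.abs_inv_bsym₀_le

/-- Split at `ε|k| = 1`. For low frequencies the symbol error `Aε|k|³` is divided by `bsym * bsym₀`,
which grows like `k⁴`. For high frequencies the symbols need not be close, but each inverse is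
`O(ε²)`, hence `O(ε)`. -/
theorem exists_abs_inv_bsym_sub_le : ∃ C, 0 ≤ C ∧ ∀ ε, 0 < ε → ε ≤ 1 → ∀ k,
    |(bsym α ε k)⁻¹ - (bsym₀ α k)⁻¹| ≤ C * ε := by
  obtain ⟨q, hq, hlow⟩ := h.exists_le_bsym
  have hd := h.d₁_pos
  set p := 4 * Real.pi ^ 2 / d₁ α with hp
  have hp0 : 0 < p := by positivity
  set A := 2 * Real.pi ^ 3 * (∫ ξ in Ioi (0 : ℝ), α ξ * ξ ^ 5) with hA
  have hA0 : 0 ≤ A := mul_nonneg (by positivity)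
    (setIntegral_nonneg measurableSet_Ioi fun ξ hξ => h.α_moment_nonneg 5 hξ)
  refine ⟨A * (1 + 1 / q) / p + (1 / q + 1 / p), by positivity, fun ε hε hε1 k => ?_⟩
  have hb := h.one_le_bsym ε k
  have hb0 := h.one_le_bsym₀ k
  have hbl := hlow ε hε k
  have hb0e : bsym₀ α k = 1 + k ^ 2 * p := bsym₀_eq α k
  rcases le_total (ε * |k|) 1 with hk | hk
  · have hk2 : k ^ 2 ≤ (ε ^ 2)⁻¹ := by
      rw [← sq_abs, ← one_div, le_div_iff₀ (by positivity), ← mul_pow, mul_comm |k| ε]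
      exact pow_le_one₀ (by positivity) hk
    rw [min_eq_left hk2] at hbl
    have e : (bsym α ε k)⁻¹ - (bsym₀ α k)⁻¹
        = -(bsym α ε k - bsym₀ α k) / (bsym α ε k * bsym₀ α k) := by
      field_simp
      ring
    -- The cube is shared out: `bsym` absorbs `|k| ≤ 1 + k²` and `bsym₀` absorbs `k²`.
    have h1 : |k| * k ^ 2 ≤ (1 + 1 / q) / p * (bsym α ε k * bsym₀ α k) := by
      have h2 : |k| ≤ (1 + 1 / q) * bsym α ε k := by
        have : |k| ≤ 1 + k ^ 2 := by rw [← sq_abs]; nlinarith [sq_nonneg (|k| - 1)]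
        have h3 : (1 + 1 / q) * (1 + q * k ^ 2) = 1 + k ^ 2 + (1 / q + q * k ^ 2) := by
          field_simp; ring
        have h4 : 0 ≤ 1 / q + q * k ^ 2 := by positivity
        have h5 : (1 + 1 / q) * (1 + q * k ^ 2) ≤ (1 + 1 / q) * bsym α ε k := by gcongr
        linarith
      have h6 : k ^ 2 ≤ bsym₀ α k / p := by
        rw [le_div_iff₀ hp0, hb0e]; linarith
      calc |k| * k ^ 2 ≤ ((1 + 1 / q) * bsym α ε k) * (bsym₀ α k / p) := by gcongr
        _ = _ := by ring
    have h7 := h.abs_bsym_sub_le hε k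
    rw [← hA] at h7
    rw [e, abs_div, abs_neg, abs_of_pos (by positivity : 0 < bsym α ε k * bsym₀ α k),
      div_le_iff₀ (by positivity)]
    refine h7.trans ?_
    have e3 : |k| ^ 3 = |k| * k ^ 2 := by rw [← sq_abs]; ring
    rw [e3]
    calc A * ε * (|k| * k ^ 2) ≤ A * ε * ((1 + 1 / q) / p * (bsym α ε k * bsym₀ α k)) := by gcongr
      _ = (A * (1 + 1 / q) / p) * ε * (bsym α ε k * bsym₀ α k) := by ring
      _ ≤ _ := by
        gcongr
        have : 0 ≤ 1 / q + 1 / p := by positivity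
        linarith
  · have hk2 : (ε ^ 2)⁻¹ ≤ k ^ 2 := by
      rw [← sq_abs k, ← one_div, div_le_iff₀ (by positivity), ← mul_pow, mul_comm |k| ε]
      exact one_le_pow₀ hk
    rw [min_eq_right hk2] at hbl
    have h1 : (bsym α ε k)⁻¹ ≤ 1 / q * ε := by
      rw [inv_le_comm₀ (by positivity) (by positivity)]
      have e1 : (1 / q * ε)⁻¹ = q * ε⁻¹ := by field_simp
      have e2 : ε⁻¹ ≤ (ε ^ 2)⁻¹ := by
        apply inv_anti₀ (by positivity); nlinarith
      rw [e1]
      nlinarith [mul_le_mul_of_nonneg_left e2 hq.le]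
    have h2 : (bsym₀ α k)⁻¹ ≤ 1 / p * ε := by
      rw [inv_le_comm₀ (by positivity) (by positivity)]
      have e1 : (1 / p * ε)⁻¹ = p * ε⁻¹ := by field_simp
      have e2 : ε⁻¹ ≤ (ε ^ 2)⁻¹ := by
        apply inv_anti₀ (by positivity); nlinarith
      rw [e1, hb0e]
      nlinarith [mul_le_mul_of_nonneg_left (e2.trans hk2) hp0.le]
    refine (abs_sub _ _).trans ?_
    rw [abs_of_nonneg (by positivity), abs_of_nonneg (by positivity)]
    have : 0 ≤ A * (1 + 1 / q) / p * ε := by positivity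
    linarith

/-! ### Convergence of the quadratic part -/

/-- `1 - A_η²` costs two derivatives, which `B₀⁻¹` supplies: `3(πηk)²` equals `3/4 * d₁ * η²` times
`(2πk)²/d₁`. -/
theorem abs_one_sub_sy_sq_div_bsym₀_le (η k : ℝ) :
    |(1 - sy η k ^ 2) * (bsym₀ α k)⁻¹| ≤ 3 / 4 * d₁ α * η ^ 2 := by
  have hd := h.d₁_pos
  have h1 := one_sub_sinc_sq_le (Real.pi * η * k)
  have hb := h.one_le_bsym₀ k
  rw [abs_of_nonneg (mul_nonneg (one_sub_sy_sq_nonneg _ _) (by positivity)), ← div_eq_mul_inv,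
    div_le_iff₀ (by positivity)]
  refine h1.trans ?_
  rw [bsym₀]
  have : 3 / 4 * d₁ α * η ^ 2 * (1 + (2 * Real.pi * k) ^ 2 / d₁ α)
      = 3 / 4 * d₁ α * η ^ 2 + 3 * (Real.pi * η * k) ^ 2 := by
    field_simp; ring
  rw [this]
  have : 0 ≤ 3 / 4 * d₁ α * η ^ 2 := by positivity
  linarith

end Admissible

theorem bddMeas_W₀ (α β : ℝ → ℝ) : BddMeas (W₀ α β) :=
  .of_continuous (continuous_W₀ α β) (abs_W₀_le α β)

/-- A commutator estimate: the difference at `x` averages `(avg η W₀ x - W₀ y) * V y` over the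
window. Only `W₀` is differenced, so no regularity of `V` is needed and the result is dominated by
`L * η * avg η |V|`. -/
theorem norm_avgProd_sub_le (α β : ℝ → ℝ) {L : ℝ}
    (hL : ∀ x y, |W₀ α β x - W₀ α β y| ≤ L * |x - y|) {η : ℝ} (hη : 0 < η) (V : L2) :
    ‖avgProd α β η V - opA η (fmul (W₀ α β) (bddMeas_W₀ α β) V)‖ ≤ L * η * ‖V‖ := by
  have hL0 : 0 ≤ L := by simpa using (abs_nonneg _).trans (hL 1 0)
  set Y := fmul (W₀ α β) (bddMeas_W₀ α β) V
  have h1 : ‖avgProd α β η V - opA η Y‖ ≤ L * η * ‖opA η |V|‖ := by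
    refine Lp.norm_le_mul_norm_of_ae_le_mul ?_
    filter_upwards [(memLp_avg_W₀_mul α β η V).coeFn_toLp, opA_ae η Y, opA_ae η |V|,
      Lp.coeFn_sub (avgProd α β η V) (opA η Y)] with x hx1 hx2 hx3 hx4
    rw [hx4, Pi.sub_apply, hx2, hx3]
    have hx1' : avgProd α β η V x = avg η (W₀ α β) x * avg η V x := hx1
    rw [hx1', avg_congr (fmul_ae (W₀ α β) (bddMeas_W₀ α β) V), avg_congr (Lp.coeFn_abs V)]
    have hle : x - η / 2 ≤ x + η / 2 := by linarith
    have hiV := intervalIntegrable_L2 V (x - η / 2) (x + η / 2)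
    have hi1 : IntervalIntegrable (fun y => W₀ α β y * V y) volume (x - η / 2) (x + η / 2) :=
      hiV.continuousOn_mul (continuous_W₀ α β).continuousOn
    have e : avg η (W₀ α β) x * avg η V x - avg η (fun y => W₀ α β y • V y) x =
        η⁻¹ * ∫ y in (x - η / 2)..(x + η / 2), (avg η (W₀ α β) x - W₀ α β y) * V y := by
      simp only [sub_mul, smul_eq_mul]
      rw [intervalIntegral.integral_sub (hiV.const_mul _) hi1,
        intervalIntegral.integral_const_mul]
      simp only [avg]
      ring
    have hnn : 0 ≤ avg η (fun y => |V y|) x :=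
      mul_nonneg (by positivity) (intervalIntegral.integral_nonneg hle fun y _ => abs_nonneg _)
    rw [e, Real.norm_eq_abs, Real.norm_of_nonneg hnn, abs_mul, abs_of_pos (inv_pos.2 hη)]
    have e2 : L * η * avg η (fun y => |V y|) x =
        η⁻¹ * ∫ y in (x - η / 2)..(x + η / 2), L * η * |V y| := by
      rw [intervalIntegral.integral_const_mul, avg]; ring
    rw [e2]
    refine mul_le_mul_of_nonneg_left ?_ (by positivity)
    refine (Real.norm_eq_abs _).symm.le.trans (intervalIntegral.norm_integral_le_of_norm_le hle
      (Eventually.of_forall fun y hy => ?_) (hiV.abs.const_mul _))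
    rw [norm_mul, Real.norm_eq_abs, Real.norm_eq_abs]
    refine mul_le_mul_of_nonneg_right ?_ (abs_nonneg _)
    refine abs_avg_sub_le (continuous_W₀ α β) hL hη (abs_le.2 ⟨?_, ?_⟩) <;>
      linarith [hy.1, hy.2]
  refine h1.trans ?_
  have h2 : ‖opA η |V|‖ ≤ ‖V‖ := (norm_opA_le hη _).trans (norm_abs_eq_norm V).le
  gcongr

namespace Admissible

variable {α β : ℝ → ℝ} (h : Admissible α β)

include h

theorem norm_inv_bsym₀_opA_avgProd_sub_le {L : ℝ}
    (hL : ∀ x y, |W₀ α β x - W₀ α β y| ≤ L * |x - y|) {η : ℝ} (hη : 0 < η) (V : L2) :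
    ‖fmul _ h.bddMeas_inv_bsym₀ (Φ (opA η (avgProd α β η V) -
      fmul (W₀ α β) (bddMeas_W₀ α β) V))‖ ≤
      (3 / 4 * d₁ α * |3 * d₁ α / (2 * d₂ α β)| * η ^ 2 + L * η) * ‖V‖ := by
  have hd := h.d₁_pos
  set Y := fmul (W₀ α β) (bddMeas_W₀ α β) V with hY
  set E := avgProd α β η V - opA η Y with hE
  have hm : BddMeas fun k => (1 - sy η k ^ 2) * (bsym₀ α k)⁻¹ :=
    ⟨(measurable_const.sub ((continuous_sy η).measurable.pow_const 2)).mul h.bddMeas_inv_bsym₀.1,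
      _, h.abs_one_sub_sy_sq_div_bsym₀_le η⟩
  -- With `E` the commutator, `A(AY + E) - Y = AE - (1 - A²)Y`: the first term is small by itself,
  -- the second only after applying `B₀⁻¹`.
  have e : fmul _ h.bddMeas_inv_bsym₀ (Φ (opA η (avgProd α β η V) - Y)) =
      fmul _ h.bddMeas_inv_bsym₀ (Φ (opA η E)) - fmul _ hm (Φ Y) := by
    have e1 : avgProd α β η V = opA η Y + E := by rw [hE]; abel
    have e2 : fmul _ h.bddMeas_inv_bsym₀ (Φ (opA η (opA η Y))) =
        fmul _ h.bddMeas_inv_bsym₀ (Φ Y) - fmul _ hm (Φ Y) := by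
      rw [Φ_opA hη, Φ_opA hη]
      set s := fmul (sy η) (bddMeas_sy η) (Φ Y)
      set r := fmul (sy η) (bddMeas_sy η) s
      apply Lp.ext
      filter_upwards [fmul_ae _ h.bddMeas_inv_bsym₀ r, fmul_ae (sy η) (bddMeas_sy η) s,
        fmul_ae (sy η) (bddMeas_sy η) (Φ Y), fmul_ae _ hm (Φ Y),
        fmul_ae _ h.bddMeas_inv_bsym₀ (Φ Y),
        Lp.coeFn_sub (fmul _ h.bddMeas_inv_bsym₀ (Φ Y)) (fmul _ hm (Φ Y))]
        with k h1 h2 h3 h4 h5 h6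
      rw [h6, Pi.sub_apply, h1, h2, h3, h4, h5]
      simp only [Complex.real_smul]
      push_cast
      ring
    rw [e1, opA_add, map_sub, map_add, map_sub, map_add, e2]
    abel
  rw [e]
  refine (norm_sub_le _ _).trans ?_
  have h1 : ‖fmul _ h.bddMeas_inv_bsym₀ (Φ (opA η E))‖ ≤ L * η * ‖V‖ := by
    refine (norm_fmul_le _ h.abs_inv_bsym₀_le _).trans ?_
    rw [one_mul, norm_Φ]
    exact (norm_opA_le hη E).trans (norm_avgProd_sub_le α β hL hη V)
  have h2 : ‖fmul _ hm (Φ Y)‖ ≤ 3 / 4 * d₁ α * η ^ 2 * (|3 * d₁ α / (2 * d₂ α β)| * ‖V‖) := by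
    refine (norm_fmul_le _ (h.abs_one_sub_sy_sq_div_bsym₀_le η) _).trans ?_
    rw [norm_Φ]
    have := norm_fmul_le (bddMeas_W₀ α β) (abs_W₀_le α β) V
    gcongr
  linarith

theorem exists_norm_inv_bsym₀_opM_sub_le : ∃ C, 0 ≤ C ∧ ∀ ε, 0 < ε → ε ≤ 1 → ∀ V : L2,
    ‖fmul _ h.bddMeas_inv_bsym₀ (Φ (opM α β ε V -
      (2 * ∫ ξ in Ioi (0 : ℝ), β ξ * ξ ^ 3) • fmul (W₀ α β) (bddMeas_W₀ α β) V))‖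
      ≤ C * ε * ‖V‖ := by
  obtain ⟨L, hL⟩ := exists_lipschitz_W₀ α β
  have hL0 : 0 ≤ L := by simpa using (abs_nonneg _).trans (hL 1 0)
  have hd := h.d₁_pos
  set A := 3 / 4 * d₁ α * |3 * d₁ α / (2 * d₂ α β)| with hA
  have hA0 : 0 ≤ A := by positivity
  have hi5 := h.β_five'.integrableOn_pow
  have hi4 := h.integrableOn_β_four
  -- At `η = εξ` the errors `Aη²` and `Lη`, weighted by `β ξ³`, produce the fifth and fourth
  -- moments; `ε² ≤ ε` unifies the powers.
  refine ⟨2 * ∫ ξ in Ioi (0 : ℝ), ((β ξ * ξ ^ 5) * A + (β ξ * ξ ^ 4) * L), ?_,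
    fun ε hε hε1 V => ?_⟩
  · refine mul_nonneg (by norm_num) (setIntegral_nonneg measurableSet_Ioi fun ξ hξ => ?_)
    have hξ0 : (0 : ℝ) < ξ := hξ
    have := h.β_nonneg ξ hξ
    positivity
  set Y := fmul (W₀ α β) (bddMeas_W₀ α β) V with hY
  have hI := h.integrableOn_integrandM hε V
  have hI2 : IntegrableOn (fun ξ => (β ξ * ξ ^ 3) • Y) (Ioi 0) :=
    h.β_three'.integrableOn_pow.smul_const Y
  have e : opM α β ε V - (2 * ∫ ξ in Ioi (0 : ℝ), β ξ * ξ ^ 3) • Y =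
      (2 : ℝ) • ∫ ξ in Ioi (0 : ℝ), (integrandM α β ε V ξ - (β ξ * ξ ^ 3) • Y) := by
    rw [integral_sub hI hI2, smul_sub, integral_smul_const, smul_smul, opM]
  rw [e, map_smul, map_smul, norm_smul, Real.norm_of_nonneg (by norm_num : (0 : ℝ) ≤ 2), mul_assoc,
    mul_assoc]
  refine mul_le_mul_of_nonneg_left ?_ (by norm_num)
  have hI3 : IntegrableOn (fun ξ => integrandM α β ε V ξ - (β ξ * ξ ^ 3) • Y) (Ioi 0) :=
    hI.sub hI2
  rw [← Φ.integral_comp_comm hI3, ← (fmul _ h.bddMeas_inv_bsym₀).integral_comp_comm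
    (Φ.integrable_comp hI3), ← integral_mul_const]
  refine norm_integral_le_of_norm_le (((hi5.mul_const A).add (hi4.mul_const L)).mul_const _) ?_
  filter_upwards [ae_restrict_mem measurableSet_Ioi] with ξ hξ
  have hξ0 : (0 : ℝ) < ξ := hξ
  have hβ := h.β_nonneg ξ hξ
  have e2 : integrandM α β ε V ξ - (β ξ * ξ ^ 3) • Y =
      (β ξ * ξ ^ 3) • (opA (ε * ξ) (avgProd α β (ε * ξ) V) - Y) := by
    rw [smul_sub]; rfl
  rw [e2, map_smul, map_smul, norm_smul, Real.norm_of_nonneg (by positivity)]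
  refine (mul_le_mul_of_nonneg_left
    (h.norm_inv_bsym₀_opA_avgProd_sub_le hL (mul_pos hε hξ0) V) (by positivity)).trans ?_
  rw [← hA]
  have h3 : A * (ε * ξ) ^ 2 + L * (ε * ξ) ≤ (A * ξ ^ 2 + L * ξ) * ε := by
    have : A * (ε * ξ) ^ 2 = A * ξ ^ 2 * ε * ε := by ring
    have h4 : A * ξ ^ 2 * ε * ε ≤ A * ξ ^ 2 * ε := mul_le_of_le_one_right (by positivity) hε1
    linarith
  calc β ξ * ξ ^ 3 * ((A * (ε * ξ) ^ 2 + L * (ε * ξ)) * ‖V‖)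
      ≤ β ξ * ξ ^ 3 * (((A * ξ ^ 2 + L * ξ) * ε) * ‖V‖) := by gcongr
    _ = _ := by ring

theorem norm_opM_le {ε : ℝ} (hε : 0 < ε) (V : L2) :
    ‖opM α β ε V‖ ≤ 2 * ((∫ ξ in Ioi (0 : ℝ), |β ξ * ξ ^ 3|) *
      |3 * d₁ α / (2 * d₂ α β)|) * ‖V‖ := by
  rw [opM, norm_smul, Real.norm_of_nonneg (by norm_num : (0 : ℝ) ≤ 2), mul_assoc, mul_assoc]
  refine mul_le_mul_of_nonneg_left ?_ (by norm_num)
  exact norm_integral_smul_le h.β_three'.integrableOn_pow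
    (fun ξ hξ => (isAdmissibleFamily_M α β hε).bound ξ hξ V)

end Admissible

/-! ### The linearized profile equation

The equation `u'' = 4c² u - 12c² sech²(cx) u` has the odd solution `solOdd` and the even solution
`solEven`; solving with variation of constants gives an a priori bound for even functions. -/

/-- The decaying odd solution. -/
def solOdd (c x : ℝ) : ℝ := Real.sinh (c * x) / Real.cosh (c * x) ^ 3

/-- The derivative of `solOdd`. -/
def solOdd' (c x : ℝ) : ℝ := c * (3 - 2 * Real.cosh (c * x) ^ 2) / Real.cosh (c * x) ^ 4

/-- The growing even solution. -/
def solEven (c x : ℝ) : ℝ :=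
  5 + 2 * Real.cosh (c * x) ^ 2 - 15 / Real.cosh (c * x) ^ 2 + 15 * (c * x) * solOdd c x

/-- The derivative of `solEven`. -/
def solEven' (c x : ℝ) : ℝ :=
  c * (4 * Real.cosh (c * x) * Real.sinh (c * x) + 45 * solOdd c x) + 15 * (c * x) * solOdd' c x

theorem hasDerivAt_cosh_mul (c x : ℝ) :
    HasDerivAt (fun x => Real.cosh (c * x)) (c * Real.sinh (c * x)) x := by
  have := ((hasDerivAt_id x).const_mul c).cosh
  simpa [mul_comm] using this

theorem hasDerivAt_sinh_mul (c x : ℝ) :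
    HasDerivAt (fun x => Real.sinh (c * x)) (c * Real.cosh (c * x)) x := by
  have := ((hasDerivAt_id x).const_mul c).sinh
  simpa [mul_comm] using this

theorem hasDerivAt_solOdd (c x : ℝ) : HasDerivAt (solOdd c) (solOdd' c x) x := by
  have hc := (Real.cosh_pos (c * x)).ne'
  refine ((hasDerivAt_sinh_mul c x).fun_div ((hasDerivAt_cosh_mul c x).fun_pow 3)
    (pow_ne_zero 3 hc)).congr_deriv ?_
  rw [solOdd']
  have := Real.sinh_sq (c * x)
  field_simp
  norm_num
  linear_combination (-3 * c * Real.cosh (c * x) ^ 2) * this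

/-- Differentiating the wave equation shows that `W₀'`, a multiple of `solOdd`, solves the
linearized equation. It is the kernel element that the restriction to even functions removes. -/
theorem hasDerivAt_solOdd' (c x : ℝ) : HasDerivAt (solOdd' c)
    (4 * c ^ 2 * solOdd c x - 12 * c ^ 2 * (1 / Real.cosh (c * x) ^ 2) * solOdd c x) x := by
  have hc := (Real.cosh_pos (c * x)).ne'
  refine ((((((hasDerivAt_cosh_mul c x).fun_pow 2).const_mul 2).const_sub 3).const_mul c).fun_div
    ((hasDerivAt_cosh_mul c x).fun_pow 4) (pow_ne_zero 4 hc)).congr_deriv ?_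
  rw [solOdd]
  field_simp
  norm_num
  ring

theorem hasDerivAt_solEven (c x : ℝ) : HasDerivAt (solEven c) (solEven' c x) x := by
  have hc := (Real.cosh_pos (c * x)).ne'
  have h1 := ((hasDerivAt_cosh_mul c x).fun_pow 2)
  have h2 := (((hasDerivAt_id x).const_mul c).const_mul 15).fun_mul (hasDerivAt_solOdd c x)
  refine ((((h1.const_mul 2).const_add 5).fun_sub ((hasDerivAt_const x (15 : ℝ)).fun_div h1
    (pow_ne_zero 2 hc))).fun_add h2).congr_deriv ?_
  simp only [solEven', id]
  have e : solOdd c x = Real.sinh (c * x) / Real.cosh (c * x) ^ 3 := rfl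
  rw [e]
  field_simp
  norm_num
  ring

theorem hasDerivAt_solEven' (c x : ℝ) : HasDerivAt (solEven' c)
    (4 * c ^ 2 * solEven c x - 12 * c ^ 2 * (1 / Real.cosh (c * x) ^ 2) * solEven c x) x := by
  have hc := (Real.cosh_pos (c * x)).ne'
  have h1 := ((hasDerivAt_cosh_mul c x).const_mul 4).fun_mul (hasDerivAt_sinh_mul c x)
  have h2 := (((hasDerivAt_id x).const_mul c).const_mul 15).fun_mul (hasDerivAt_solOdd' c x)
  refine (((h1.fun_add ((hasDerivAt_solOdd c x).const_mul 45)).const_mul c).fun_add h2).congr_deriv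
    ?_
  simp only [solEven, id]
  have e : solOdd c x = Real.sinh (c * x) / Real.cosh (c * x) ^ 3 := rfl
  have e' : solOdd' c x = c * (3 - 2 * Real.cosh (c * x) ^ 2) / Real.cosh (c * x) ^ 4 := rfl
  have hs := Real.sinh_sq (c * x)
  rw [e, e']
  field_simp
  ring_nf
  rw [hs]
  ring

/-- The constant is the value at `x = 0`, where `solEven = -8`, `solOdd = 0` and `solOdd' = c`. -/
theorem wronskian_sol (c x : ℝ) :
    solEven c x * solOdd' c x - solOdd c x * solEven' c x = -(8 * c) := by
  have hc := (Real.cosh_pos (c * x)).ne'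
  have hs := Real.sinh_sq (c * x)
  simp only [solEven, solEven', solOdd, solOdd']
  field_simp
  ring_nf
  rw [hs]
  ring

theorem inv_cosh_le {y : ℝ} : 1 / Real.cosh y ≤ 2 * Real.exp (-y) := by
  rw [div_le_iff₀ (Real.cosh_pos y), Real.cosh_eq]
  have h : Real.exp (-y) * Real.exp y = 1 := by rw [← Real.exp_add]; simp
  nlinarith [sq_nonneg (Real.exp (-y))]

theorem inv_cosh_sq_le {y : ℝ} : 1 / Real.cosh y ^ 2 ≤ 4 * Real.exp (-y) ^ 2 := by
  have h := inv_cosh_le (y := y)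
  have h0 : 0 ≤ 1 / Real.cosh y := by have := Real.cosh_pos y; positivity
  have := pow_le_pow_left₀ h0 h 2
  rw [div_pow, one_pow] at this
  linarith [this, (by ring : (2 * Real.exp (-y)) ^ 2 = 4 * Real.exp (-y) ^ 2)]

theorem abs_solOdd_le (c x : ℝ) : |solOdd c x| ≤ 4 * Real.exp (-(c * x)) ^ 2 := by
  have hc := Real.cosh_pos (c * x)
  have e : solOdd c x = Real.sinh (c * x) / Real.cosh (c * x) * (1 / Real.cosh (c * x) ^ 2) := by
    rw [solOdd]; field_simp
  rw [e, abs_mul, abs_of_pos (by positivity : 0 < 1 / Real.cosh (c * x) ^ 2)]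
  refine (mul_le_of_le_one_left (by positivity) (sinh_div_cosh_le _)).trans inv_cosh_sq_le

theorem abs_solOdd'_le {c : ℝ} (hc : 0 < c) (x : ℝ) :
    |solOdd' c x| ≤ 5 * c * (4 * Real.exp (-(c * x)) ^ 2) := by
  have h := Real.one_le_cosh (c * x)
  set C := Real.cosh (c * x) ^ 2 with hC
  have hC1 : 1 ≤ C := one_le_pow₀ h
  have e : solOdd' c x = c * ((3 - 2 * C) / C) * (1 / C) := by
    have : Real.cosh (c * x) ^ 4 = C ^ 2 := by rw [hC]; ring
    rw [solOdd', this]; field_simp; rw [hC]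
  rw [e, abs_mul, abs_mul, abs_of_pos hc, abs_of_pos (by positivity : 0 < 1 / C)]
  have h1 : |(3 - 2 * C) / C| ≤ 5 := by
    rw [abs_div, abs_of_pos (by positivity : 0 < C), div_le_iff₀ (by positivity), abs_le]
    constructor <;> linarith
  have h2 : 1 / C ≤ 4 * Real.exp (-(c * x)) ^ 2 := inv_cosh_sq_le
  calc c * |(3 - 2 * C) / C| * (1 / C) ≤ c * 5 * (4 * Real.exp (-(c * x)) ^ 2) := by gcongr
    _ = _ := by ring

theorem abs_solEven_le {c : ℝ} (hc : 0 < c) {x : ℝ} (hx : 0 ≤ x) :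
    |solEven c x| ≤ 82 * Real.exp (c * x) ^ 2 := by
  set y := c * x with hy
  have hy0 : 0 ≤ y := by positivity
  have hE : 1 ≤ Real.exp y := Real.one_le_exp hy0
  have hE2 : 1 ≤ Real.exp y ^ 2 := one_le_pow₀ hE
  have h1 : Real.cosh y ^ 2 ≤ Real.exp y ^ 2 := by
    have : Real.cosh y ≤ Real.exp y := by
      rw [Real.cosh_eq]; linarith [Real.exp_le_exp.2 (by linarith : -y ≤ y)]
    exact pow_le_pow_left₀ (Real.cosh_pos y).le this 2
  have hc1 : 1 ≤ Real.cosh y ^ 2 := one_le_pow₀ (Real.one_le_cosh y)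
  have h2 : 15 / Real.cosh y ^ 2 ≤ 15 := by
    rw [div_le_iff₀ (by positivity)]; linarith
  have h20 : 0 ≤ 15 / Real.cosh y ^ 2 := by positivity
  have h3 : |15 * y * solOdd c x| ≤ 60 := by
    have h4 := abs_solOdd_le c x
    rw [← hy] at h4
    have h5 : y * Real.exp (-y) ^ 2 ≤ 1 := by
      have h6 : y ≤ Real.exp y := by linarith [Real.add_one_le_exp y]
      have h7 : Real.exp y * Real.exp (-y) = 1 := by rw [← Real.exp_add]; simp
      have h8 : Real.exp (-y) ≤ 1 := Real.exp_le_one_iff.2 (by linarith)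
      calc y * Real.exp (-y) ^ 2 ≤ Real.exp y * Real.exp (-y) ^ 2 := by gcongr
        _ = (Real.exp y * Real.exp (-y)) * Real.exp (-y) := by ring
        _ ≤ 1 := by rw [h7, one_mul]; exact h8
    rw [abs_mul, abs_of_nonneg (by positivity)]
    calc 15 * y * |solOdd c x| ≤ 15 * y * (4 * Real.exp (-y) ^ 2) := by gcongr
      _ = 60 * (y * Real.exp (-y) ^ 2) := by ring
      _ ≤ 60 := by linarith
  -- The constant is `82 = 5 + 2 + 15 + 60`, each term being compared with `exp(cx)² ≥ 1`.
  have h3' := abs_le.1 h3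
  rw [solEven, ← hy, abs_le]
  constructor <;> nlinarith

theorem continuous_solOdd (c : ℝ) : Continuous (solOdd c) :=
  continuous_iff_continuousAt.2 fun x => (hasDerivAt_solOdd c x).continuousAt

theorem continuous_solEven (c : ℝ) : Continuous (solEven c) :=
  continuous_iff_continuousAt.2 fun x => (hasDerivAt_solEven c x).continuousAt

section ODE

variable {c : ℝ} (hc : 0 < c) {u u' f : ℝ → ℝ} (hu : ∀ x, HasDerivAt u (u' x) x)
  (hu' : ∀ x, HasDerivAt u'
    (4 * c ^ 2 * u x - 12 * c ^ 2 * (1 / Real.cosh (c * x) ^ 2) * (u x + f x)) x)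
  {K : ℝ} (hf : Continuous f) (hfK : ∀ x, |f x| ≤ K)

include hu hu' in
-- The homogeneous terms cancel for any solution `p`, leaving only the forcing by `f`.
theorem hasDerivAt_wronskian {p p' : ℝ → ℝ} {x : ℝ} (hp : HasDerivAt p (p' x) x)
    (hp' : HasDerivAt p' (4 * c ^ 2 * p x - 12 * c ^ 2 * (1 / Real.cosh (c * x) ^ 2) * p x) x) :
    HasDerivAt (fun x => u x * p' x - u' x * p x)
      (12 * c ^ 2 * (1 / Real.cosh (c * x) ^ 2) * f x * p x) x := by
  refine (((hu x).fun_mul hp').fun_sub ((hu' x).fun_mul hp)).congr_deriv ?_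
  ring

theorem continuous_forcing (c : ℝ) {f p : ℝ → ℝ} (hf : Continuous f) (hp : Continuous p) :
    Continuous fun x => 12 * c ^ 2 * (1 / Real.cosh (c * x) ^ 2) * f x * p x := by
  have : ∀ x : ℝ, Real.cosh (c * x) ^ 2 ≠ 0 := fun x => pow_ne_zero 2 (Real.cosh_pos _).ne'
  fun_prop (disch := assumption)

include hc hf hfK in
theorem integrableOn_exp_mul_abs : IntegrableOn (fun y => Real.exp (-c * y) * |f y|) (Ioi 0) := by
  refine ((exp_neg_integrableOn_Ioi 0 hc).mul_const K).mono'
    (by fun_prop : Continuous fun y => Real.exp (-c * y) * |f y|).aestronglyMeasurable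
    (Eventually.of_forall fun y => ?_)
  rw [Real.norm_of_nonneg (by positivity)]
  exact mul_le_mul_of_nonneg_left (hfK y) (Real.exp_pos _).le

include hc hu hu' hf hfK in
-- Boundedness of `u` and `u'` makes this Wronskian vanish at `+∞`, so it is integrated from `x` to
-- `∞`. Of the four factors `exp(-cy)` from `sech²` and `solOdd`, three are bounded by their value
-- at `x` and one stays in the integral; `192 = 12 * 4 * 4`.
theorem abs_wronskian_odd_le (huK : ∀ x, |u x| ≤ K) (huK' : ∀ x, |u' x| ≤ K) {x : ℝ} (hx : 0 ≤ x) :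
    |u x * solOdd' c x - u' x * solOdd c x| ≤
      192 * c ^ 2 * Real.exp (-(c * x)) ^ 3 * ∫ y in Ioi (0 : ℝ), Real.exp (-c * y) * |f y| := by
  have hN := integrableOn_exp_mul_abs hc hf hfK
  have hK : 0 ≤ K := (abs_nonneg _).trans (hfK 0)
  have hlim : Tendsto (fun x => u x * solOdd' c x - u' x * solOdd c x) atTop (𝓝 0) := by
    have h1 : Tendsto (fun x => K * (5 * c + 1) * (4 * Real.exp (-(c * x)) ^ 2)) atTop (𝓝 0) := by
      have h2 : Tendsto (fun x => Real.exp (-(c * x))) atTop (𝓝 0) :=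
        Real.tendsto_exp_neg_atTop_nhds_zero.comp (tendsto_id.const_mul_atTop hc)
      have := ((h2.pow 2).const_mul 4).const_mul (K * (5 * c + 1))
      simpa using this
    refine squeeze_zero_norm (fun x => ?_) h1
    refine (norm_sub_le _ _).trans ?_
    rw [norm_mul, norm_mul]
    calc _ ≤ K * (5 * c * (4 * Real.exp (-(c * x)) ^ 2)) + K * (4 * Real.exp (-(c * x)) ^ 2) :=
          add_le_add (mul_le_mul (huK x) (abs_solOdd'_le hc x) (abs_nonneg _) hK)
            (mul_le_mul (huK' x) (abs_solOdd_le c x) (abs_nonneg _) hK)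
      _ = _ := by ring
  have hcont := continuous_forcing c hf (continuous_solOdd c)
  have hbd : ∀ y ∈ Ioi x, ‖12 * c ^ 2 * (1 / Real.cosh (c * y) ^ 2) * f y * solOdd c y‖ ≤
      192 * c ^ 2 * Real.exp (-(c * x)) ^ 3 * (Real.exp (-c * y) * |f y|) := by
    intro y hy
    have hy' : x ≤ y := le_of_lt hy
    have h1 : 1 / Real.cosh (c * y) ^ 2 ≤ 4 * Real.exp (-(c * y)) ^ 2 := inv_cosh_sq_le
    have h0 : 0 ≤ 1 / Real.cosh (c * y) ^ 2 := by positivity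
    have h3 : Real.exp (-(c * y)) ≤ Real.exp (-(c * x)) :=
      Real.exp_le_exp.2 (by nlinarith)
    have e : -c * y = -(c * y) := by ring
    rw [Real.norm_eq_abs, abs_mul, abs_mul, abs_of_nonneg (by positivity), e]
    calc _ ≤ 12 * c ^ 2 * (4 * Real.exp (-(c * y)) ^ 2) * |f y| * (4 * Real.exp (-(c * y)) ^ 2) := by
          have := abs_solOdd_le c y
          gcongr
      _ = 192 * c ^ 2 * Real.exp (-(c * y)) ^ 3 * (Real.exp (-(c * y)) * |f y|) := by ring
      _ ≤ _ := by gcongr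
  have hN' := (hN.mono_set (Ioi_subset_Ioi hx)).const_mul (192 * c ^ 2 * Real.exp (-(c * x)) ^ 3)
  have hint : IntegrableOn (fun y => 12 * c ^ 2 * (1 / Real.cosh (c * y) ^ 2) * f y * solOdd c y)
      (Ioi x) := hN'.mono' hcont.aestronglyMeasurable
        ((ae_restrict_mem measurableSet_Ioi).mono hbd)
  have h := integral_Ioi_of_hasDerivAt_of_tendsto'
    (fun y _ => hasDerivAt_wronskian hu hu' (hasDerivAt_solOdd c y) (hasDerivAt_solOdd' c y)) hint hlim
  rw [zero_sub] at h
  rw [← abs_neg, ← h, ← Real.norm_eq_abs]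
  refine (norm_integral_le_of_norm_le hN' ((ae_restrict_mem measurableSet_Ioi).mono hbd)).trans ?_
  rw [integral_const_mul]
  refine mul_le_mul_of_nonneg_left ?_ (by positivity)
  exact setIntegral_mono_set hN (Eventually.of_forall fun y => by positivity)
    (Ioi_subset_Ioi hx).eventuallyLE

include hc hu hu' hf hfK in
-- This Wronskian vanishes at 0 because `u' 0 = 0`, which is where evenness enters; it is integrated
-- from 0. The decay of `sech²` cancels the growth of `solEven`, and `1 ≤ exp(cx) * exp(-cy)`
-- restores the weight; `3936 = 12 * 4 * 82`.
theorem abs_wronskian_even_le (h0 : u' 0 = 0) {x : ℝ} (hx : 0 ≤ x) :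
    |u x * solEven' c x - u' x * solEven c x| ≤
      3936 * c ^ 2 * Real.exp (c * x) * ∫ y in Ioi (0 : ℝ), Real.exp (-c * y) * |f y| := by
  have hN := integrableOn_exp_mul_abs hc hf hfK
  have hcont := continuous_forcing c hf (continuous_solEven c)
  have h := intervalIntegral.integral_eq_sub_of_hasDerivAt (a := 0) (b := x)
    (fun y _ => hasDerivAt_wronskian hu hu' (hasDerivAt_solEven c y) (hasDerivAt_solEven' c y))
    (hcont.intervalIntegrable _ _)
  have h00 : u 0 * solEven' c 0 - u' 0 * solEven c 0 = 0 := by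
    simp [h0, solEven', solOdd]
  rw [h00, sub_zero, intervalIntegral.integral_of_le hx] at h
  rw [← h, ← Real.norm_eq_abs]
  have hN' := (hN.mono_set (Ioc_subset_Ioi_self : Ioc 0 x ⊆ Ioi 0)).const_mul
    (3936 * c ^ 2 * Real.exp (c * x))
  refine (norm_integral_le_of_norm_le hN'
    ((ae_restrict_mem measurableSet_Ioc).mono fun y hy => ?_)).trans ?_
  · have h1 : 1 / Real.cosh (c * y) ^ 2 ≤ 4 * Real.exp (-(c * y)) ^ 2 := inv_cosh_sq_le
    have h0 : 0 ≤ 1 / Real.cosh (c * y) ^ 2 := by positivity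
    have h3 : Real.exp (c * y) ≤ Real.exp (c * x) := Real.exp_le_exp.2 (by nlinarith [hy.2])
    have e : -c * y = -(c * y) := by ring
    have e2 : Real.exp (c * y) * Real.exp (-(c * y)) = 1 := by rw [← Real.exp_add]; simp
    rw [Real.norm_eq_abs, abs_mul, abs_mul, abs_of_nonneg (by positivity), e]
    calc _ ≤ 12 * c ^ 2 * (4 * Real.exp (-(c * y)) ^ 2) * |f y| * (82 * Real.exp (c * y) ^ 2) := by
          have := abs_solEven_le hc hy.1.le
          gcongr
      _ = 3936 * c ^ 2 * (Real.exp (c * y) * Real.exp (-(c * y))) *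
            (Real.exp (c * y) * Real.exp (-(c * y))) * |f y| := by ring
      _ = 3936 * c ^ 2 * Real.exp (c * y) * (Real.exp (-(c * y)) * |f y|) := by
          conv_lhs => rw [e2, mul_one]
          conv_rhs => rw [mul_assoc, ← mul_assoc (Real.exp (c * y)), e2]
          ring
      _ ≤ _ := by gcongr
  · rw [integral_const_mul]
    refine mul_le_mul_of_nonneg_left ?_ (by positivity)
    exact setIntegral_mono_set hN (Eventually.of_forall fun y => by positivity)
      Ioc_subset_Ioi_self.eventuallyLE

include hc hu hu' hf hfK in
theorem abs_le_of_ode (huK : ∀ x, |u x| ≤ K) (huK' : ∀ x, |u' x| ≤ K) (h0 : u' 0 = 0)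
    {x : ℝ} (hx : 0 ≤ x) :
    |u x| ≤ 3936 * c * Real.exp (-(c * x)) *
      ∫ y in Ioi (0 : ℝ), Real.exp (-c * y) * |f y| := by
  set N := ∫ y in Ioi (0 : ℝ), Real.exp (-c * y) * |f y| with hN
  have hN0 : 0 ≤ N := setIntegral_nonneg measurableSet_Ioi fun y _ => by positivity
  have h1 := abs_wronskian_odd_le hc hu hu' hf hfK huK huK' hx
  have h2 := abs_wronskian_even_le hc hu hu' hf hfK h0 hx
  rw [← hN] at h1 h2
  have hW := wronskian_sol c x
  set w := u x * solOdd' c x - u' x * solOdd c x with hw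
  set w₂ := u x * solEven' c x - u' x * solEven c x with hw₂
  -- Eliminate `u'` from the two Wronskians by Cramer's rule. In both products growth meets stronger
  -- decay, leaving `exp(-cx)`.
  have e : 8 * c * u x = solOdd c x * w₂ - solEven c x * w := by
    have : -(8 * c) * u x = solEven c x * w - solOdd c x * w₂ := by
      rw [← hW, hw, hw₂]; ring
    linarith
  have e2 : Real.exp (c * x) * Real.exp (-(c * x)) = 1 := by rw [← Real.exp_add]; simp
  have h3 : |solOdd c x * w₂| ≤ 15744 * c ^ 2 * Real.exp (-(c * x)) * N := by
    rw [abs_mul]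
    calc _ ≤ (4 * Real.exp (-(c * x)) ^ 2) * (3936 * c ^ 2 * Real.exp (c * x) * N) :=
          mul_le_mul (abs_solOdd_le c x) h2 (abs_nonneg _) (by positivity)
      _ = 15744 * c ^ 2 * Real.exp (-(c * x)) * N * (Real.exp (c * x) * Real.exp (-(c * x))) := by
          ring
      _ = _ := by rw [e2, mul_one]
  have h4 : |solEven c x * w| ≤ 15744 * c ^ 2 * Real.exp (-(c * x)) * N := by
    rw [abs_mul]
    calc _ ≤ (82 * Real.exp (c * x) ^ 2) * (192 * c ^ 2 * Real.exp (-(c * x)) ^ 3 * N) :=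
          mul_le_mul (abs_solEven_le hc hx) h1 (abs_nonneg _) (by positivity)
      _ = 15744 * c ^ 2 * Real.exp (-(c * x)) * N * (Real.exp (c * x) * Real.exp (-(c * x))) ^ 2 := by
          ring
      _ = _ := by rw [e2, one_pow, mul_one]
  have h5 : 8 * c * |u x| ≤ 8 * c * (3936 * c * Real.exp (-(c * x)) * N) := by
    have : |8 * c * u x| = 8 * c * |u x| := by rw [abs_mul, abs_of_pos (by positivity)]
    rw [← this, e]
    refine (abs_sub _ _).trans ?_
    refine (add_le_add h3 h4).trans (le_of_eq ?_)
    ring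
  exact le_of_mul_le_mul_left h5 (by positivity)

include hc hf hfK in
-- Cauchy–Schwarz, obtained by expanding the square of `|f|` minus its projection `2cN exp(-cy)`.
theorem sq_integral_exp_mul_abs_le (hf2 : Integrable fun x => f x ^ 2) :
    (∫ y in Ioi (0 : ℝ), Real.exp (-c * y) * |f y|) ^ 2 ≤ 1 / (2 * c) * ∫ y, f y ^ 2 := by
  set N := ∫ y in Ioi (0 : ℝ), Real.exp (-c * y) * |f y| with hN
  have hNi := integrableOn_exp_mul_abs hc hf hfK
  have hE : IntegrableOn (fun y => Real.exp (-(2 * c) * y)) (Ioi 0) :=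
    exp_neg_integrableOn_Ioi 0 (by positivity)
  have hE1 : ∫ y in Ioi (0 : ℝ), Real.exp (-(2 * c) * y) = 1 / (2 * c) := by
    rw [integral_exp_mul_Ioi (by linarith)]; simp
  have h1 : 0 ≤ ∫ y in Ioi (0 : ℝ), (|f y| - 2 * c * N * Real.exp (-c * y)) ^ 2 :=
    setIntegral_nonneg measurableSet_Ioi fun y _ => sq_nonneg _
  have e : ∀ y, (|f y| - 2 * c * N * Real.exp (-c * y)) ^ 2 = f y ^ 2 -
      4 * c * N * (Real.exp (-c * y) * |f y|) + (2 * c * N) ^ 2 * Real.exp (-(2 * c) * y) := by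
    intro y
    have : Real.exp (-(2 * c) * y) = Real.exp (-c * y) ^ 2 := by
      rw [← Real.exp_nat_mul]; congr 1; push_cast; ring
    rw [this, ← sq_abs (f y)]
    ring
  simp_rw [e] at h1
  have hi : IntegrableOn (fun y => f y ^ 2 - 4 * c * N * (Real.exp (-c * y) * |f y|)) (Ioi 0) :=
    hf2.integrableOn.sub (hNi.const_mul _)
  rw [integral_add hi (hE.const_mul _), integral_sub hf2.integrableOn (hNi.const_mul _), integral_const_mul, integral_const_mul, hE1,
    ← hN] at h1
  have h2 : ∫ y in Ioi (0 : ℝ), f y ^ 2 ≤ ∫ y, f y ^ 2 :=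
    setIntegral_le_integral hf2 (Eventually.of_forall fun y => sq_nonneg _)
  have h3 : (2 * c * N) ^ 2 * (1 / (2 * c)) = 2 * c * N ^ 2 := by field_simp
  rw [h3] at h1
  rw [one_div, inv_mul_eq_div, le_div_iff₀ (by positivity)]
  nlinarith

theorem integrable_comp_abs {g : ℝ → ℝ} (hg : IntegrableOn g (Ioi 0)) :
    Integrable fun x => g |x| := by
  have h1 : IntegrableOn (fun x => g |x|) (Ioi 0) :=
    hg.congr_fun (fun x hx => by rw [abs_of_pos hx]) measurableSet_Ioi
  have h2 : IntegrableOn (fun x => g |x|) (Iio 0) := by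
    have h3 : IntegrableOn (fun x => g (-x)) (Iio 0) := by
      have := hg.comp_neg
      simpa using this
    exact h3.congr_fun (fun x hx => by rw [abs_of_neg hx]) measurableSet_Iio
  rw [← integrableOn_univ, ← Iic_union_Ioi (a := (0 : ℝ)), integrableOn_union,
    integrableOn_Iic_iff_integrableOn_Iio]
  exact ⟨h2, h1⟩

include hc hu hu' hf hfK in
-- Squaring the pointwise bound contributes `c²`, the integral of `exp(-2c|x|)` contributes `1/c`,
-- and `N²` contributes `1/(2c)`. The powers of `c` cancel, so the constant depends on nothing.
theorem integral_sq_le_of_ode (huK : ∀ x, |u x| ≤ K) (huK' : ∀ x, |u' x| ≤ K)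
    (heven : ∀ x, u (-x) = u x) (h0 : u' 0 = 0) (hf2 : Integrable fun x => f x ^ 2) :
    Integrable (fun x => u x ^ 2) ∧ ∫ x, u x ^ 2 ≤ 3936 ^ 2 * ∫ x, f x ^ 2 := by
  set N := ∫ y in Ioi (0 : ℝ), Real.exp (-c * y) * |f y| with hN
  have hN0 : 0 ≤ N := setIntegral_nonneg measurableSet_Ioi fun y _ => by positivity
  have hNf := sq_integral_exp_mul_abs_le hc hf hfK hf2
  rw [← hN] at hNf
  have hb : ∀ x, u x ^ 2 ≤ (3936 * c * N) ^ 2 * Real.exp (-(2 * c) * |x|) := by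
    intro x
    have h1 : |u x| ≤ 3936 * c * Real.exp (-(c * |x|)) * N := by
      have h2 := abs_le_of_ode hc hu hu' hf hfK huK huK' h0 (abs_nonneg x)
      rcases abs_cases x with ⟨hx, -⟩ | ⟨hx, -⟩
      · rwa [hx] at h2 ⊢
      · rw [hx] at h2 ⊢
        rwa [heven] at h2
    have h3 := pow_le_pow_left₀ (abs_nonneg _) h1 2
    rw [sq_abs] at h3
    have : Real.exp (-(2 * c) * |x|) = Real.exp (-(c * |x|)) ^ 2 := by
      rw [← Real.exp_nat_mul]; congr 1; push_cast; ring
    rw [this]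
    linarith [h3, (by ring : (3936 * c * Real.exp (-(c * |x|)) * N) ^ 2 =
      (3936 * c * N) ^ 2 * Real.exp (-(c * |x|)) ^ 2)]
  have hE : IntegrableOn (fun y => Real.exp (-(2 * c) * y)) (Ioi 0) :=
    exp_neg_integrableOn_Ioi 0 (by positivity)
  have hE1 : ∫ y in Ioi (0 : ℝ), Real.exp (-(2 * c) * y) = 1 / (2 * c) := by
    rw [integral_exp_mul_Ioi (by linarith)]; simp
  have hEa : Integrable fun x : ℝ => Real.exp (-(2 * c) * |x|) :=
    integrable_comp_abs hE
  have hint : Integrable (fun x => u x ^ 2) := by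
    have huc : Continuous u := continuous_iff_continuousAt.2 fun x => (hu x).continuousAt
    refine (hEa.const_mul ((3936 * c * N) ^ 2)).mono' (huc.pow 2).aestronglyMeasurable
      (Eventually.of_forall fun x => ?_)
    rw [Real.norm_of_nonneg (sq_nonneg _)]
    exact hb x
  refine ⟨hint, (integral_mono hint (hEa.const_mul ((3936 * c * N) ^ 2)) hb).trans ?_⟩
  rw [integral_const_mul, integral_comp_abs (f := fun y => Real.exp (-(2 * c) * y)), hE1]
  have h5 : 0 ≤ ∫ x, f x ^ 2 := integral_nonneg fun x => sq_nonneg _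
  have h4 : (3936 * c * N) ^ 2 * (2 * (1 / (2 * c))) = 3936 ^ 2 * (c * N ^ 2) := by
    field_simp
  rw [h4]
  refine mul_le_mul_of_nonneg_left ?_ (by norm_num)
  have h6 : c * N ^ 2 ≤ c * (1 / (2 * c) * ∫ x, f x ^ 2) := by gcongr
  have h7 : c * (1 / (2 * c) * ∫ x, f x ^ 2) = (∫ x, f x ^ 2) / 2 := by field_simp
  linarith

end ODE

/-! ### The limit operator -/

/-- The inverse symbol is `(1 + ‖·‖²)⁻¹` rescaled by `2π/√d₁`. -/
theorem hasTemperateGrowth_inv_bsym₀ {α : ℝ → ℝ} (hd : 0 < d₁ α) :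
    Function.HasTemperateGrowth fun k => (bsym₀ α k)⁻¹ := by
  have h1 := (Function.hasTemperateGrowth_one_add_norm_sq_rpow ℝ (-1)).comp
    (ContinuousLinearMap.hasTemperateGrowth ((2 * Real.pi / √(d₁ α)) • ContinuousLinearMap.id ℝ ℝ))
  refine (congrArg Function.HasTemperateGrowth ?_).mpr h1
  funext k
  simp only [Function.comp, Real.rpow_neg_one, smul_apply,
    ContinuousLinearMap.id_apply, smul_eq_mul, Real.norm_eq_abs, sq_abs]
  rw [bsym₀]
  congr 2
  have hs := Real.sq_sqrt hd.le
  have hs0 : √(d₁ α) ≠ 0 := (Real.sqrt_pos.2 hd).ne'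
  conv_lhs => rw [← hs]
  field_simp

/-- Multiplication by the inverse symbol preserves Schwartz functions. Thus `B₀⁻¹ g` is a classical
solution, bounded together with its derivative, as the Wronskian argument requires. -/
theorem exists_schwartz_resolvent {α : ℝ → ℝ} (hd : 0 < d₁ α) (g : 𝓢(ℝ, ℂ)) :
    ∃ U U' U'' : 𝓢(ℝ, ℂ), (∀ x, HasDerivAt U (U' x) x) ∧ (∀ x, HasDerivAt U' (U'' x) x) ∧
      (∀ x, U'' x = d₁ α * (U x - g x)) ∧
      ∀ k, (𝓕 U : 𝓢(ℝ, ℂ)) k = ((bsym₀ α k)⁻¹ : ℝ) • (𝓕 g : 𝓢(ℝ, ℂ)) k := by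
  have hm := hasTemperateGrowth_inv_bsym₀ hd
  set U : 𝓢(ℝ, ℂ) := 𝓕⁻ (SchwartzMap.smulLeftCLM ℂ (fun k => (bsym₀ α k)⁻¹) (𝓕 g)) with hU
  have hFU : ∀ k, (𝓕 U : 𝓢(ℝ, ℂ)) k = ((bsym₀ α k)⁻¹ : ℝ) • (𝓕 g : 𝓢(ℝ, ℂ)) k := by
    intro k
    rw [hU, FourierTransform.fourier_fourierInv_eq, SchwartzMap.smulLeftCLM_apply_apply hm]
  have hderiv : ∀ (f : 𝓢(ℝ, ℂ)) x, HasDerivAt f (SchwartzMap.derivCLM ℝ ℂ f x) x := fun f x => by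
    rw [SchwartzMap.derivCLM_apply]; exact f.differentiableAt.hasDerivAt
  have hF : ∀ (f : 𝓢(ℝ, ℂ)) k, (𝓕 (SchwartzMap.derivCLM ℝ ℂ f) : 𝓢(ℝ, ℂ)) k =
      (2 * Real.pi * Complex.I * k) * (𝓕 f : 𝓢(ℝ, ℂ)) k := fun f k => by
    have e : ((SchwartzMap.derivCLM ℝ ℂ f : 𝓢(ℝ, ℂ)) : ℝ → ℂ) = deriv f := by
      funext x; exact SchwartzMap.derivCLM_apply ℝ f x
    rw [SchwartzMap.fourier_coe, SchwartzMap.fourier_coe, e, Real.fourier_deriv f.integrable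
      f.differentiable (by rw [← e]; exact (SchwartzMap.derivCLM ℝ ℂ f).integrable)]
    rfl
  refine ⟨U, SchwartzMap.derivCLM ℝ ℂ U, SchwartzMap.derivCLM ℝ ℂ (SchwartzMap.derivCLM ℝ ℂ U),
    hderiv U, hderiv _, fun x => ?_, hFU⟩
  have key : SchwartzMap.derivCLM ℝ ℂ (SchwartzMap.derivCLM ℝ ℂ U) = (d₁ α : ℂ) • (U - g) := by
    apply (FourierTransform.fourierEquiv ℂ 𝓢(ℝ, ℂ)).injective
    rw [map_smul, map_sub]
    simp only [FourierTransform.fourierEquiv_apply]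
    ext k
    rw [hF, hF, smul_apply, sub_apply, hFU, Complex.real_smul]
    have hb : bsym₀ α k ≠ 0 := by
      have : 0 ≤ (2 * Real.pi * k) ^ 2 / d₁ α := by positivity
      rw [bsym₀]; positivity
    have hb' : (bsym₀ α k : ℂ) ≠ 0 := by exact_mod_cast hb
    have hbe : (2 * Real.pi * Complex.I * k) * (2 * Real.pi * Complex.I * k) =
        (d₁ α : ℂ) * (1 - bsym₀ α k) := by
      have hd' : (d₁ α : ℂ) ≠ 0 := by exact_mod_cast hd.ne'
      rw [bsym₀]
      push_cast
      field_simp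
      linear_combination (4 * (Real.pi : ℂ) ^ 2 * k ^ 2) * Complex.I_sq
    rw [← mul_assoc, hbe, smul_eq_mul]
    push_cast
    field_simp
  rw [key]
  rfl

theorem exists_forall_norm_le_schwartz {F : Type*} [NormedAddCommGroup F] [NormedSpace ℝ F]
    (f : 𝓢(ℝ, F)) : ∃ K, ∀ x, ‖f x‖ ≤ K :=
  ⟨_, fun x => f.toBoundedContinuousFunction.norm_coe_le_norm x⟩

theorem eq_toLp_of_ae {F : Type*} [NormedAddCommGroup F] [NormedSpace ℝ F]
    {v : Lp F 2 (volume : Measure ℝ)} {f : 𝓢(ℝ, F)} (h : ∀ᵐ x, v x = f x) : v = f.toLp 2 := by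
  apply Lp.ext
  filter_upwards [h, f.coeFn_toLp 2 volume] with x h1 h2
  rw [h1, h2]

theorem integrable_norm_sq_H2 (v : H2) : Integrable fun x => ‖v x‖ ^ 2 :=
  (Lp.memLp v).integrable_norm_pow (by norm_num)

/-- The resolvent is constructed complex valued and without parity. Passing to the real even part
does not increase the defect, so neither property has to be proved for it. -/
theorem integral_sq_even_part_le {G : ℝ → ℂ} (hG : Integrable fun x => ‖G x‖ ^ 2)
    (hGc : Continuous G) :
    Integrable (fun x => (((G x).re + (G (-x)).re) / 2) ^ 2) ∧
      ∫ x, (((G x).re + (G (-x)).re) / 2) ^ 2 ≤ ∫ x, ‖G x‖ ^ 2 := by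
  have hG' : Integrable fun x => ‖G (-x)‖ ^ 2 := hG.comp_neg
  have hb : ∀ x, (((G x).re + (G (-x)).re) / 2) ^ 2 ≤ (1 / 2) * (‖G x‖ ^ 2 + ‖G (-x)‖ ^ 2) := by
    intro x
    have h1 : (G x).re ^ 2 ≤ ‖G x‖ ^ 2 := by
      rw [← sq_abs]; exact pow_le_pow_left₀ (abs_nonneg _) (Complex.abs_re_le_norm _) 2
    have h2 : (G (-x)).re ^ 2 ≤ ‖G (-x)‖ ^ 2 := by
      rw [← sq_abs]; exact pow_le_pow_left₀ (abs_nonneg _) (Complex.abs_re_le_norm _) 2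
    nlinarith [sq_nonneg ((G x).re - (G (-x)).re)]
  have hs : Integrable fun x => (1 / 2) * (‖G x‖ ^ 2 + ‖G (-x)‖ ^ 2) := (hG.add hG').const_mul _
  have hi : Integrable (fun x => (((G x).re + (G (-x)).re) / 2) ^ 2) := by
    refine hs.mono' (Continuous.aestronglyMeasurable ?_) (Eventually.of_forall fun x => ?_)
    · have := Complex.continuous_re
      fun_prop
    · rw [Real.norm_of_nonneg (sq_nonneg _)]; exact hb x
  refine ⟨hi, (integral_mono hi hs hb).trans (le_of_eq ?_)⟩
  rw [integral_const_mul, integral_add hG hG', integral_neg_eq_self (fun x => ‖G x‖ ^ 2)]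
  ring

/-- The a priori bound for the linearized profile equation, for a Schwartz solution. -/
theorem integral_sq_le_of_schwartz_solution {c : ℝ} (hc0 : 0 < c) {φ : ℝ → ℝ} (hφ : Continuous φ)
    (hφe : ∀ x, φ (-x) = φ x) {K₃ : ℝ} (hK₃ : ∀ x, |φ x| ≤ K₃) {U U' U'' : 𝓢(ℝ, ℂ)}
    (hU : ∀ x, HasDerivAt U (U' x) x) (hU' : ∀ x, HasDerivAt U' (U'' x) x)
    (hUode : ∀ x, U'' x = (4 * c ^ 2 : ℝ) *
      (U x - ((3 * (1 / Real.cosh (c * x) ^ 2) * φ x : ℝ) : ℂ)))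
    (hGi : Integrable fun x => ‖(φ x : ℂ) - U x‖ ^ 2) :
    ∫ x, φ x ^ 2 ≤ 6000 ^ 2 * ∫ x, ‖(φ x : ℂ) - U x‖ ^ 2 := by
  have hGc : Continuous fun x => (φ x : ℂ) - U x :=
    (Complex.continuous_ofReal.comp hφ).sub U.continuous
  obtain ⟨hfi, hfle⟩ := integral_sq_even_part_le hGi hGc
  set u : ℝ → ℝ := fun x => ((U x).re + (U (-x)).re) / 2 with hu
  set u' : ℝ → ℝ := fun x => ((U' x).re - (U' (-x)).re) / 2 with hu'
  have hfu : ∀ x, (((φ x : ℂ) - U x).re + ((φ (-x) : ℂ) - U (-x)).re) / 2 = φ x - u x := fun x => by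
    simp only [hu, Complex.sub_re, Complex.ofReal_re, hφe]; ring
  simp_rw [hfu] at hfi hfle
  have hre : ∀ {p p' : 𝓢(ℝ, ℂ)}, (∀ x, HasDerivAt p (p' x) x) →
      ∀ x, HasDerivAt (fun x => (p x).re) (p' x).re x := fun hp x =>
    Complex.reCLM.hasFDerivAt.comp_hasDerivAt x (hp x)
  have hre' : ∀ {p p' : 𝓢(ℝ, ℂ)}, (∀ x, HasDerivAt p (p' x) x) →
      ∀ x, HasDerivAt (fun x => (p (-x)).re) (-(p' (-x)).re) x := fun hp x => by
    have := (hre hp (-x)).scomp x (hasDerivAt_neg x)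
    exact this.congr_deriv (by simp)
  have hud : ∀ x, HasDerivAt u (u' x) x := fun x => by
    refine (((hre hU x).fun_add (hre' hU x)).div_const 2).congr_deriv ?_
    simp only [hu']; ring
  have hud' : ∀ x, HasDerivAt u' (4 * c ^ 2 * u x -
      12 * c ^ 2 * (1 / Real.cosh (c * x) ^ 2) * (u x + (φ x - u x))) x := fun x => by
    refine (((hre hU' x).fun_sub (hre' hU' x)).div_const 2).congr_deriv ?_
    have r1 : ∀ y, (U'' y).re =
        4 * c ^ 2 * ((U y).re - 3 * (1 / Real.cosh (c * y) ^ 2) * φ y) := fun y => by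
      rw [hUode, Complex.re_ofReal_mul, Complex.sub_re, Complex.ofReal_re]
    rw [r1, r1, mul_neg, Real.cosh_neg, hφe]
    simp only [hu]
    ring
  obtain ⟨K₁, hK₁⟩ := exists_forall_norm_le_schwartz U
  obtain ⟨K₂, hK₂⟩ := exists_forall_norm_le_schwartz U'
  have hK₁0 := (norm_nonneg _).trans (hK₁ 0)
  have hK₂0 := (norm_nonneg _).trans (hK₂ 0)
  have hK₃0 := (abs_nonneg _).trans (hK₃ 0)
  have huK : ∀ x, |u x| ≤ K₁ := fun x => by
    have h1 := abs_le.1 ((Complex.abs_re_le_norm (U x)).trans (hK₁ x))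
    have h2 := abs_le.1 ((Complex.abs_re_le_norm (U (-x))).trans (hK₁ (-x)))
    simp only [hu]
    rw [abs_le]; constructor <;> linarith
  have huK' : ∀ x, |u' x| ≤ K₂ := fun x => by
    have h1 := abs_le.1 ((Complex.abs_re_le_norm (U' x)).trans (hK₂ x))
    have h2 := abs_le.1 ((Complex.abs_re_le_norm (U' (-x))).trans (hK₂ (-x)))
    simp only [hu']
    rw [abs_le]; constructor <;> linarith
  have huc : Continuous u := continuous_iff_continuousAt.2 fun x => (hud x).continuousAt
  -- `K` only has to dominate `u`, `u'` and `φ - u` at once; it does not enter the conclusion.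
  obtain ⟨hui, hule⟩ := integral_sq_le_of_ode (K := K₁ + K₂ + K₃) hc0 hud hud'
    (hφ.sub huc)
    (fun x => by
      have := hK₃ x
      refine (abs_sub _ _).trans ?_
      linarith [huK x])
    (fun x => (huK x).trans (by linarith)) (fun x => (huK' x).trans (by linarith))
    (fun x => by simp only [hu, neg_neg]; ring) (by simp [hu']) hfi
  -- From `φ = u + (φ - u)` the factor is `2 * 3936² + 2`, which is below `6000²`.
  have hVle : ∫ x, φ x ^ 2 ≤ ∫ x, (2 * u x ^ 2 + 2 * (φ x - u x) ^ 2) := by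
    refine integral_mono_of_nonneg (Eventually.of_forall fun x => sq_nonneg _)
      ((hui.const_mul 2).add (hfi.const_mul 2)) (Eventually.of_forall fun x => ?_)
    simp only
    nlinarith [sq_nonneg (φ x - 2 * u x)]
  rw [integral_add (hui.const_mul 2) (hfi.const_mul 2), integral_const_mul,
    integral_const_mul] at hVle
  have h0 : 0 ≤ ∫ x, (φ x - u x) ^ 2 := integral_nonneg fun x => sq_nonneg _
  linarith

namespace Admissible

variable {α β : ℝ → ℝ} (h : Admissible α β)

include h

/-- Since `d₂ = d₁ ∫βξ³`, the coefficient `β` drops out and the potential of the limit problem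
depends on `d₁` alone. -/
theorem moment_mul_W₀ (x : ℝ) : (2 * ∫ ξ in Ioi (0 : ℝ), β ξ * ξ ^ 3) * W₀ α β x =
    3 * (1 / Real.cosh (1 / 2 * √(d₁ α) * x) ^ 2) := by
  have h1 := h.d₁_pos
  have hb := h.β_three'.integral_pow_pos
  have h2 : d₂ α β = (∫ ξ in Ioi (0 : ℝ), β ξ * ξ ^ 3) * d₁ α := by
    unfold d₂ d₁; ring
  rw [W₀, h2]
  field_simp

/-- Plancherel turns the defect of the limit equation into an `L²` distance to the classical
solution `U`. -/
theorem norm_Φ_sub_eq {Y V : L2} {g U : 𝓢(ℝ, ℂ)} (hY : ∀ᵐ x, (Y x : ℂ) = g x)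
    (hUF : ∀ k, (𝓕 U : 𝓢(ℝ, ℂ)) k = ((bsym₀ α k)⁻¹ : ℝ) • (𝓕 g : 𝓢(ℝ, ℂ)) k) :
    ‖Φ V - fmul _ h.bddMeas_inv_bsym₀ (Φ Y)‖ = ‖iotaC V - (U.toLp 2 : H2)‖ := by
  have e1 : Φ Y = (𝓕 g : 𝓢(ℝ, ℂ)).toLp 2 := by
    have : iotaC Y = g.toLp 2 := by
      refine eq_toLp_of_ae ?_
      filter_upwards [iotaC_ae Y, hY] with x h1 h2
      rw [h1, h2]
    rw [Φ_apply, this, SchwartzMap.toLp_fourier_eq]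
  have e2 : fmul _ h.bddMeas_inv_bsym₀ (Φ Y) = 𝓕 (U.toLp 2 : H2) := by
    rw [SchwartzMap.toLp_fourier_eq, e1]
    refine eq_toLp_of_ae ?_
    filter_upwards [fmul_ae _ h.bddMeas_inv_bsym₀ ((𝓕 g : 𝓢(ℝ, ℂ)).toLp 2),
      (𝓕 g : 𝓢(ℝ, ℂ)).coeFn_toLp 2 volume] with k h1 h2
    rw [h1, h2, hUF]
  have e3 : Φ V - 𝓕 (U.toLp 2 : H2) = 𝓕 (iotaC V - (U.toLp 2 : H2)) :=
    ((Lp.fourierTransformₗᵢ ℝ ℂ).map_sub _ _).symm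
  rw [e2, e3, Lp.norm_fourier_eq]

omit h in
theorem exists_schwartz_sech_sq_mul (c : ℝ) {φ : ℝ → ℝ} (hφc : HasCompactSupport φ)
    (hφ : ContDiff ℝ (⊤ : ℕ∞) φ) :
    ∃ g : 𝓢(ℝ, ℂ), ∀ x, g x = ((3 * (1 / Real.cosh (c * x) ^ 2) * φ x : ℝ) : ℂ) := by
  have hqc : ContDiff ℝ (⊤ : ℕ∞) fun x => 3 * (1 / Real.cosh (c * x) ^ 2) := by
    refine contDiff_const.mul (contDiff_const.div ?_ fun x => pow_ne_zero 2 (Real.cosh_pos _).ne')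
    exact ((contDiff_const.mul contDiff_id).cosh).pow 2
  have h1 : HasCompactSupport fun x => 3 * (1 / Real.cosh (c * x) ^ 2) * φ x := hφc.mul_left
  have h2 : HasCompactSupport fun x => ((3 * (1 / Real.cosh (c * x) ^ 2) * φ x : ℝ) : ℂ) :=
    h1.comp_left (g := fun x : ℝ => (x : ℂ)) (by simp)
  have h3 : ContDiff ℝ (⊤ : ℕ∞) fun x => ((3 * (1 / Real.cosh (c * x) ^ 2) * φ x : ℝ) : ℂ) :=
    Complex.ofRealCLM.contDiff.comp (hqc.mul hφ)
  exact ⟨h2.toSchwartzMap h3, fun x => rfl⟩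

theorem norm_le_of_smooth_even {φ : ℝ → ℝ} (hφc : HasCompactSupport φ)
    (hφ : ContDiff ℝ (⊤ : ℕ∞) φ) (hφe : ∀ x, φ (-x) = φ x) {V : L2} (hV : ∀ᵐ x, V x = φ x) :
    ‖V‖ ≤ 6000 * ‖Φ V - fmul _ h.bddMeas_inv_bsym₀ (Φ
      ((2 * ∫ ξ in Ioi (0 : ℝ), β ξ * ξ ^ 3) • fmul (W₀ α β) (bddMeas_W₀ α β) V))‖ := by
  have hd := h.d₁_pos
  obtain ⟨c, hc⟩ : ∃ c, c = 1 / 2 * √(d₁ α) := ⟨_, rfl⟩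
  have hc0 : 0 < c := by rw [hc]; positivity
  have hc4 : d₁ α = 4 * c ^ 2 := by
    rw [hc, mul_pow, Real.sq_sqrt hd.le]; ring
  have hq := h.moment_mul_W₀
  rw [← hc] at hq
  obtain ⟨g, hg⟩ := exists_schwartz_sech_sq_mul c hφc hφ
  obtain ⟨U, U', U'', hU, hU', hUode, hUF⟩ := exists_schwartz_resolvent hd g
  rw [h.norm_Φ_sub_eq (g := g) (U := U) ?_ hUF]
  · have hGF : (fun x => ‖(iotaC V - (U.toLp 2 : H2) : H2) x‖ ^ 2) =ᵐ[volume]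
        fun x => ‖(φ x : ℂ) - U x‖ ^ 2 := by
      filter_upwards [iotaC_ae V, hV, U.coeFn_toLp 2 volume,
        Lp.coeFn_sub (iotaC V) (U.toLp 2 : H2)] with x h1 h2 h3 h4
      rw [h4, Pi.sub_apply, h1, h2, h3]
    have hGi : Integrable fun x => ‖(φ x : ℂ) - U x‖ ^ 2 :=
      (integrable_norm_sq_H2 _).congr hGF
    refine le_of_sq_le_sq ?_ (by positivity)
    have hVφ : ∫ x, V x ^ 2 = ∫ x, φ x ^ 2 :=
      integral_congr_ae (hV.mono fun x hx => by simp only [hx])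
    rw [mul_pow, norm_sq_H2, integral_congr_ae hGF, norm_sq_L2, hVφ]
    obtain ⟨K, hK⟩ := exists_forall_norm_le_schwartz (hφc.toSchwartzMap hφ)
    exact integral_sq_le_of_schwartz_solution hc0 hφ.continuous hφe (fun x => hK x) hU hU'
      (fun x => by rw [hUode, hg, hc4]) hGi
  · filter_upwards [Lp.coeFn_smul (2 * ∫ ξ in Ioi (0 : ℝ), β ξ * ξ ^ 3)
        (fmul (W₀ α β) (bddMeas_W₀ α β) V), fmul_ae (W₀ α β) (bddMeas_W₀ α β) V,
        hV] with x h2 h3 h4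
    rw [h2, Pi.smul_apply, h3, h4, hg, ← hq]
    simp only [smul_eq_mul]
    congr 1
    ring

theorem norm_le_of_even {V : L2} (hV : V ∈ L2even) :
    ‖V‖ ≤ 6000 * ‖Φ V - fmul _ h.bddMeas_inv_bsym₀ (Φ
      ((2 * ∫ ξ in Ioi (0 : ℝ), β ξ * ξ ^ 3) • fmul (W₀ α β) (bddMeas_W₀ α β) V))‖ := by
  set b := 2 * ∫ ξ in Ioi (0 : ℝ), β ξ * ξ ^ 3
  -- Stating the estimate for the even part of an arbitrary `V` makes density of smooth compactly
  -- supported functions in all of `L2` sufficient.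
  let P : Set L2 := {V | ‖(1 / 2 : ℝ) • (V + reflL2 V)‖ ≤ 6000 * ‖Φ ((1 / 2 : ℝ) • (V + reflL2 V)) -
    fmul _ h.bddMeas_inv_bsym₀ (Φ
      (b • fmul (W₀ α β) (bddMeas_W₀ α β) ((1 / 2 : ℝ) • (V + reflL2 V))))‖}
  have hP : IsClosed P := isClosed_le (by fun_prop) (by fun_prop)
  have hd := Lp.dense_hasCompactSupport_contDiff (F := ℝ) (E := ℝ) (μ := volume) (p := 2)
    (by norm_num)
  have hsub : {f : L2 | ∃ g : ℝ → ℝ, f =ᵐ[volume] g ∧ HasCompactSupport g ∧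
      ContDiff ℝ (⊤ : ℕ∞) g} ⊆ P := by
    rintro f ⟨g, hfg, hgc, hg⟩
    have hgc' : HasCompactSupport fun x => g (-x) :=
      hgc.comp_homeomorph (Homeomorph.neg ℝ)
    refine h.norm_le_of_smooth_even (φ := fun x => 1 / 2 * (g x + g (-x)))
      ((hgc.add hgc').mul_left) (contDiff_const.mul (hg.add (hg.comp contDiff_neg)))
      (fun x => by rw [neg_neg]; ring) ?_
    filter_upwards [hfg, ae_neg hfg, reflL2_ae f, Lp.coeFn_add f (reflL2 f),
      Lp.coeFn_smul (1 / 2 : ℝ) (f + reflL2 f)] with x h1 h2 h3 h4 h5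
    rw [h5, Pi.smul_apply, h4, Pi.add_apply, h3, h1, h2, smul_eq_mul]
  have hVP : V ∈ P := closure_minimal hsub hP (hd V)
  have e : (1 / 2 : ℝ) • (V + reflL2 V) = V := by
    rw [mem_L2even_iff_reflL2.1 hV, ← two_smul ℝ V, smul_smul]
    norm_num
  have := hVP
  simp only [P, mem_ofPred_eq, e] at this
  exact this

end Admissible

/-! ### Uniform lower bound for the linearized operator. -/

namespace Admissible

variable {α β : ℝ → ℝ} (h : Admissible α β)

include h

theorem exists_norm_le_opL : ∃ C ε₀, 0 < C ∧ 0 < ε₀ ∧ ∀ ε, 0 < ε → ε ≤ ε₀ → ∀ V ∈ L2even,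
    ‖V‖ ≤ C * ‖opL α β ε V‖ := by
  obtain ⟨C₁, hC₁, h₁⟩ := h.exists_abs_inv_bsym_sub_le
  obtain ⟨C₂, hC₂, h₂⟩ := h.exists_norm_inv_bsym₀_opM_sub_le
  set C₃ := 2 * ((∫ ξ in Ioi (0 : ℝ), |β ξ * ξ ^ 3|) * |3 * d₁ α / (2 * d₂ α β)|) with hC₃
  have hC₃0 : 0 ≤ C₃ := by
    have : 0 ≤ ∫ ξ in Ioi (0 : ℝ), |β ξ * ξ ^ 3| := integral_nonneg fun ξ => abs_nonneg _
    positivity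
  set D := C₂ + C₁ * C₃ with hD
  have hD0 : 0 ≤ D := by positivity
  -- The limit estimate gives `‖V‖ ≤ 6000(‖opL V‖ + Dε‖V‖)`. This `ε₀` ensures `6000Dε ≤ 1/2`, and
  -- absorbing that term doubles the constant; `D + 1` avoids division by zero.
  refine ⟨12000, min 1 (1 / (12000 * (D + 1))), by norm_num, by positivity,
    fun ε hε hε₀ V hV => ?_⟩
  have hε1 : ε ≤ 1 := hε₀.trans (min_le_left _ _)
  have hεD : 12000 * (D * ε) ≤ 1 := by
    have := hε₀.trans (min_le_right _ _)
    rw [le_div_iff₀ (by positivity)] at this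
    nlinarith
  have hlim := h.norm_le_of_even hV
  set M₀ := (2 * ∫ ξ in Ioi (0 : ℝ), β ξ * ξ ^ 3) • fmul (W₀ α β) (bddMeas_W₀ α β) V with hM₀
  set M := opM α β ε V with hM
  set R := fmul (F := ℂ) _ (h.bddMeas_inv_bsym ε) with hR
  set K := fmul (F := ℂ) _ h.bddMeas_inv_bsym₀ with hK
  have e1 : R (Φ (opL α β ε V)) = Φ V - R (Φ M) := by
    rw [opL, map_sub, map_sub, h.fmul_inv_bsym_Φ_opB hε]
  -- The limit defect is the preconditioned `opL` plus two `O(ε)` errors: replacing `M₀` by `M_ε`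
  -- under `B₀⁻¹`, and replacing `B₀⁻¹` by `B_ε⁻¹`.
  have e2 : Φ V - K (Φ M₀) = R (Φ (opL α β ε V)) + K (Φ (M - M₀)) + (R (Φ M) - K (Φ M)) := by
    rw [e1, map_sub, map_sub]; abel
  have b1 : ‖R (Φ (opL α β ε V))‖ ≤ ‖opL α β ε V‖ :=
    (h.norm_fmul_inv_bsym_le ε _).trans (norm_Φ _).le
  have b2 : ‖K (Φ (M - M₀))‖ ≤ C₂ * ε * ‖V‖ := h₂ ε hε hε1 V
  have b3 : ‖R (Φ M) - K (Φ M)‖ ≤ C₁ * ε * (C₃ * ‖V‖) := by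
    have hd : ‖R (Φ M) - K (Φ M)‖ ≤ C₁ * ε * ‖Φ M‖ := by
      refine Lp.norm_le_mul_norm_of_ae_le_mul ?_
      filter_upwards [fmul_ae _ (h.bddMeas_inv_bsym ε) (Φ M), fmul_ae _ h.bddMeas_inv_bsym₀ (Φ M),
        Lp.coeFn_sub (R (Φ M)) (K (Φ M))] with k h1 h2 h3
      rw [h3, Pi.sub_apply, h1, h2, ← sub_smul, norm_smul]
      exact mul_le_mul_of_nonneg_right (h₁ ε hε hε1 k) (norm_nonneg _)
    refine hd.trans ?_
    rw [norm_Φ]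
    have := h.norm_opM_le hε V
    gcongr
  have b4 : ‖Φ V - K (Φ M₀)‖ ≤ ‖opL α β ε V‖ + D * ε * ‖V‖ := by
    rw [e2]
    refine (norm_add₃_le).trans ?_
    refine (add_le_add (add_le_add b1 b2) b3).trans (le_of_eq ?_)
    rw [hD]; ring
  have b5 := mul_le_mul_of_nonneg_right hεD (norm_nonneg V)
  linarith

end Admissible

end PeridynamicKdV

end

theorem mainTheorem3 (α β : ℝ → ℝ) (h : Admissible α β) :
    ∃ ε₀ : ℝ, 0 < ε₀ ∧ ∀ εstar : ℝ, 0 < εstar → εstar ≤ ε₀ →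
      ∃ C : ℝ, 0 < C ∧ ∀ ε : ℝ, 0 < ε → ε ≤ εstar →
        (∀ V : L2, IntegrableOn (integrandB α ε V) (Ioi 0) ∧
          IntegrableOn (integrandM α β ε V) (Ioi 0)) ∧
        ∃ Lε : L2even ≃L[ℝ] L2even,
          (∀ V : L2even, (Lε V : L2) = opL α β ε V) ∧
          ∀ G : L2even, ‖Lε.symm G‖ ≤ C * ‖G‖ := by
  obtain ⟨C, ε₀, hC, hε₀, hbound⟩ := h.exists_norm_le_opL
  -- The same `C` serves every `εstar ≤ ε₀`.
  refine ⟨ε₀, hε₀, fun εstar _ hstar => ⟨C, hC, fun ε hε hεs =>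
    ⟨fun V => ⟨h.integrableOn_integrandB hε V, h.integrableOn_integrandM hε V⟩, ?_⟩⟩⟩
  obtain ⟨T, hT, hTs, hTe⟩ := h.exists_opL_clm hε
  let T' : L2even →L[ℝ] L2even := (T.comp L2even.subtypeL).codRestrict L2even
    fun V => hTe V V.2
  obtain ⟨e, he, hes⟩ := exists_equiv_of_symmetric_of_bounded_below T'
    (fun V W => hTs V W) (C := C) fun V => by
      have := hbound ε hε (hεs.trans hstar) V V.2
      rwa [← hT] at this
  exact ⟨e, fun V => by rw [he, ← hT]; rfl, hes⟩
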